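/- Let $d\ge 3$, $A=\{1,\dots,d\}$, and let $\sigma$ be the substitution $1\mapsto 12$, $k\mapsto k+1$ for $2\le k\le d-1$, $d\mapsto 1$, regarded also as an endomorphism of the free group $F_d=F(A)$. Let $\omega=\lim_n\sigma^n(1)\in A^{\mathbb N}$ and let $S$ be the shift on $A^{\mathbb N}$. Let $A_\tau=\{1,\dots,2d-2\}$. The tree substitution $\tau$ acts on oriented graphs with edges coloured by $A_\tau$, edge by edge: an edge $(x,y,i)$ from $x$ to $y$ of colour $i\neq 2$ is replaced by $(x,y,i')$, where $i'=d$ if $i=1$, $i'=1$ if $i=d+1$, and $i'=i-1$ otherwise; an edge $(x,y,2)$ is replaced by the star with a new centre $z$, new vertices $z_1,\dots,z_{d-2}$, and the $d$ edges $(z,x,d)$, $(z,y,1)$ and $(z,z_h,d+h)$ for $1\le h\le d-2$. The new vertices created for an edge $(x,y,2)$ are distinct from each other and from $x,y$; and, for any two distinct edges of one of the trees $\tau^n(X_2)$ below, the new vertices created by the first are not vertices of the image of the second. Let $X_2$ be a tree with a single edge $(a,b,2)$, $a\ne b$, and put $T_0^s=\tau^{d-1}(X_2)$ and $T_n^s=\tau^n(T_0^s)$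 for $n\ge 0$. The root $x_0$ is the centre of the star $T_0^s$ (the new centre created from the edge of $X_2$). Every vertex of $T_n^s$ is a vertex of $T_{n+1}^s$. Let $\mathcal W_n^s$ be the set of branch points of $T_n^s$, that is, its vertices of degree $d$. For vertices $x,x'$ of $T_n^s$, let $\gamma_n(x,x')$ be the word over $A_\tau\cup\overline{A_\tau}$ read along the shortest path from $x$ to $x'$ (an edge of colour $i$ gives $i$ when followed forwards and $\overline{i}$ when followed backwards). Let $p_*$ be the monoid morphism from $(A_\tau\cup\overline{A_\tau})^*$ to $F_d$ with $p_*(k)=k$ for $1\le k\le d$, $p_*(d+k)=\sigma^k(1)$ for $1\le k\le d-2$, and $p_*(\overline{k})=p_*(k)^{-1}$. Proposition. For $x\in\bigcup_n\mathcal W_n^s$, the element $f_0(x)=\sigma^k(p_*(\gamma_k(x_0,x)))$ of $F_d$ is the same for all $k$ such that $x$ is a vertex of $T_k^s$. The map $f_0$ is a bijection from $\bigcup_{n}\mathcal W_n^s$ onto $$\{u^{-1}\in F_d : u \text{ a (possibly empty) prefix of } \omega\}.$$ Moreover, the map that sends a branch point $x$ with $f_0(x)=u^{-1}$ to $u^{-1}\omega$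 (the infinite word $V$ with $\omega=uV$, i.e. $V=S^{|u|}(\omega)$) is a bijection from $\bigcup_n\mathcal W_n^s$ onto $\{S^n(\omega) : n\in\mathbb N\}$. -/

import Mathlib

namespace TreeSubst

/-! ### Coloured graphs -/

/-- An oriented graph with vertices in `𝒱` whose edges `(x, y, c)` (from `x` to `y`)
carry a colour `c : C`. -/
@[ext]
structure ColoredGraph (𝒱 C : Type*) where
  verts : Set 𝒱
  edges : Set (𝒱 × 𝒱 × C)

/-- The graph `({x, y}, {(x, y, c)})`. -/
def edgeGraph {𝒱 C : Type*} (x y : 𝒱) (c : C) : ColoredGraph 𝒱 C where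
  verts := {x, y}
  edges := {(x, y, c)}

/-- The degree of a vertex: the number of edges adjacent to it. -/
noncomputable def degree {𝒱 C : Type*} (X : ColoredGraph 𝒱 C) (x : 𝒱) : ℕ∞ :=
  Set.encard {e ∈ X.edges | e.1 = x ∨ e.2.1 = x}

/-- `Reads X x y w`: the word `w` is read along some path of `X` from `x` to `y`. The letter
`(c, true)` stands for `c` (an edge of colour `c` travelled forwards), and `(c, false)` stands
for the letter `c` with a bar (an edge of colour `c` travelled backwards). -/
inductive Reads {𝒱 C : Type*} (X : ColoredGraph 𝒱 C) : 𝒱 → 𝒱 → List (C × Bool) → Prop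
  | nil {x : 𝒱} (hx : x ∈ X.verts) : Reads X x x []
  | forward {x y z : 𝒱} {c : C} {w : List (C × Bool)} (he : (x, z, c) ∈ X.edges)
      (hw : Reads X z y w) : Reads X x y ((c, true) :: w)
  | backward {x y z : 𝒱} {c : C} {w : List (C × Bool)} (he : (z, x, c) ∈ X.edges)
      (hw : Reads X z y w) : Reads X x y ((c, false) :: w)

/-- The path function `γ_X`: the word read along the shortest path from `x` to `y`. -/
noncomputable def pathWord {𝒱 C : Type*} (X : ColoredGraph 𝒱 C) (x y : 𝒱) : List (C × Bool) :=
  Classical.epsilon fun w => Reads X x y w ∧ ∀ w', Reads X x y w' → w.length ≤ w'.length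

/-! ### The substitution `σ`

The alphabet `{1, …, d}` is `Fin d`; the letter `k` is the element of value `k - 1`. -/

/-- The letter `1`. -/
def letter1 {d : ℕ} (hd : 3 ≤ d) : Fin d := ⟨0, by omega⟩

/-- The letter `2`. -/
def letter2 {d : ℕ} (hd : 3 ≤ d) : Fin d := ⟨1, by omega⟩

/-- The letter `d`. -/
def letterD {d : ℕ} (hd : 3 ≤ d) : Fin d := ⟨d - 1, by omega⟩

/-- The image of a letter: `1 ↦ 12`, `k ↦ k + 1` for `2 ≤ k ≤ d - 1`, `d ↦ 1`. -/
def sigmaLetter {d : ℕ} (hd : 3 ≤ d) (k : Fin d) : List (Fin d) :=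
  if k.val = 0 then [letter1 hd, letter2 hd]
  else if h : k.val + 1 < d then [⟨k.val + 1, h⟩]
  else [letter1 hd]

/-- `σ` on finite words. -/
def sigmaWord {d : ℕ} (hd : 3 ≤ d) (w : List (Fin d)) : List (Fin d) :=
  w.flatMap (sigmaLetter hd)

/-- The element of the free group represented by a positive word. -/
def toFree {d : ℕ} (w : List (Fin d)) : FreeGroup (Fin d) :=
  (w.map FreeGroup.of).prod

/-- `σ` on the free group `F_d`. -/
def sigma {d : ℕ} (hd : 3 ≤ d) : FreeGroup (Fin d) →* FreeGroup (Fin d) :=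
  FreeGroup.lift fun k => toFree (sigmaLetter hd k)

/-- The fixed point `ω = lim σ^n(1)`. The words `σ^n(1)` are prefixes of each other and
`σ^n(1)` has more than `n` letters, so the letter of index `n` of `ω` is that of `σ^n(1)`;
see `length_iterate` and `iterate_prefix_omega`. -/
def omega {d : ℕ} (hd : 3 ≤ d) : Stream' (Fin d) := fun n =>
  ((sigmaWord hd)^[n] [letter1 hd]).getD n (letter1 hd)

/-- A finite word `u` is a prefix of the infinite word `V`. -/
def IsPrefix {α : Type*} (u : List α) (V : Stream' α) : Prop :=
  ∃ V' : Stream' α, V = u ++ₛ V'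

/-! ### The tree substitution `τ` -/

/-- The alphabet `A_τ = {1, …, 2d - 2}`: `Sum.inl k` is the letter `k` of `{1, …, d}`, and
`Sum.inr h` is the letter `d + (h + 1)`, where `h = 0, …, d - 3`. -/
abbrev Color (d : ℕ) : Type := Fin d ⊕ Fin (d - 2)

/-- The colour `j` such that `τ(X_i) = X_j`, for `i ≠ 2`:
`1 ↦ d`, `i ↦ i - 1` for `3 ≤ i ≤ d`, `d + 1 ↦ 1`, `i ↦ i - 1` for `d + 2 ≤ i ≤ 2d - 2`. -/
def recolor {d : ℕ} (hd : 3 ≤ d) : Color d → Color d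
  | Sum.inl k => if k.val = 0 then Sum.inl (letterD hd) else Sum.inl ⟨k.val - 1, by omega⟩
  | Sum.inr h => if h.val = 0 then Sum.inl (letter1 hd) else Sum.inr ⟨h.val - 1, by omega⟩

/-- A naming of the vertices created by `τ`: the edge `(x, y, 2)` creates the central vertex
`new x y none` and the `d - 2` vertices `new x y (some h)`. -/
abbrev Naming (𝒱 : Type*) (d : ℕ) : Type _ := 𝒱 → 𝒱 → Option (Fin (d - 2)) → 𝒱

open Classical in
/-- The image under `τ` of the one-edge tree `({x, y}, {(x, y, c)})`. For `c = 2` it is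
the star with centre `z` and with the `d` edges `(z, x, d)`, `(z, y, 1)` and
`(z, z_h, d + h)` for `1 ≤ h ≤ d - 2`; the other edges only change colour. -/
noncomputable def tauEdge {𝒱 : Type*} {d : ℕ} (hd : 3 ≤ d) (new : Naming 𝒱 d) :
    𝒱 × 𝒱 × Color d → ColoredGraph 𝒱 (Color d)
  | (x, y, c) =>
    if c = Sum.inl (letter2 hd) then
      { verts := {x, y} ∪ Set.range (new x y)
        edges := {(new x y none, x, Sum.inl (letterD hd)),
            (new x y none, y, Sum.inl (letter1 hd))} ∪
          Set.range fun h : Fin (d - 2) => (new x y none, new x y (some h), Sum.inr h) }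
    else edgeGraph x y (recolor hd c)

/-- `τ` on graphs: the union of the images of the edges. -/
noncomputable def tau {𝒱 : Type*} {d : ℕ} (hd : 3 ≤ d) (new : Naming 𝒱 d)
    (X : ColoredGraph 𝒱 (Color d)) : ColoredGraph 𝒱 (Color d) where
  verts := ⋃ e ∈ X.edges, (tauEdge hd new e).verts
  edges := ⋃ e ∈ X.edges, (tauEdge hd new e).edges

/-- The initial tree `X_2 = ({a, b}, {(a, b, 2)})`. -/
def X₂ {𝒱 : Type*} {d : ℕ} (hd : 3 ≤ d) (a b : 𝒱) : ColoredGraph 𝒱 (Color d) :=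
  edgeGraph a b (Sum.inl (letter2 hd))

/-- The names of the created vertices make `τ` a tree substitution along the orbit of
`X_2 = ({a, b}, {(a, b, 2)})`: the `d + 1` vertices of `τ({x, y}, {(x, y, 2)})` are distinct,
and for distinct edges `e`, `e'` of a tree `τ^n(X_2)` the vertices created by `e` are
not vertices of the image of `e'`. -/
structure IsTreeSubstitution {𝒱 : Type*} {d : ℕ} (hd : 3 ≤ d) (new : Naming 𝒱 d)
    (a b : 𝒱) : Prop where
  ne : a ≠ b
  injective : ∀ x y, x ≠ y → Function.Injective (new x y)
  ne_ends : ∀ x y, x ≠ y → ∀ i, new x y i ≠ x ∧ new x y i ≠ y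
  disjoint : ∀ n : ℕ, ∀ e ∈ ((tau hd new)^[n] (X₂ hd a b)).edges,
    ∀ e' ∈ ((tau hd new)^[n] (X₂ hd a b)).edges, e ≠ e' →
      Disjoint ((tauEdge hd new e).verts \ {e.1, e.2.1}) (tauEdge hd new e').verts

/-- The simplicial trees `T_n^s = τ^n(T_0^s)`, where `T_0^s = τ^(d-1)(X_2)`. -/
noncomputable def T {𝒱 : Type*} {d : ℕ} (hd : 3 ≤ d) (new : Naming 𝒱 d) (a b : 𝒱) (n : ℕ) :
    ColoredGraph 𝒱 (Color d) :=
  (tau hd new)^[n] ((tau hd new)^[d - 1] (X₂ hd a b))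

/-- The root `x₀`, the centre of the star `T_0^s`. -/
def root {𝒱 : Type*} {d : ℕ} (new : Naming 𝒱 d) (a b : 𝒱) : 𝒱 := new a b none

/-- The set `W_n^s` of branch points of `T_n^s`: its vertices of degree `d`. -/
def W {𝒱 : Type*} {d : ℕ} (hd : 3 ≤ d) (new : Naming 𝒱 d) (a b : 𝒱) (n : ℕ) : Set 𝒱 :=
  {x ∈ (T hd new a b n).verts | degree (T hd new a b n) x = d}

/-- `p_*` on letters: `k ↦ k` for `1 ≤ k ≤ d`, and `d + k ↦ σ^k(1)` for `1 ≤ k ≤ d - 2`. -/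
def pLetter {d : ℕ} (hd : 3 ≤ d) : Color d → FreeGroup (Fin d)
  | Sum.inl k => FreeGroup.of k
  | Sum.inr h => (sigma hd)^[h.val + 1] (FreeGroup.of (letter1 hd))

/-- The monoid morphism `p_*` from words over `A_τ` and its barred copy to `F_d`. -/
def pStar {d : ℕ} (hd : 3 ≤ d) (w : List (Color d × Bool)) : FreeGroup (Fin d) :=
  (w.map fun l => if l.2 then pLetter hd l.1 else (pLetter hd l.1)⁻¹).prod

/-- The element `σ^k(p_*(γ_k(x₀, x)))` of `F_d`. -/
noncomputable def stageImage {𝒱 : Type*} {d : ℕ} (hd : 3 ≤ d) (new : Naming 𝒱 d) (a b : 𝒱)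
    (k : ℕ) (x : 𝒱) : FreeGroup (Fin d) :=
  (sigma hd)^[k] (pStar hd (pathWord (T hd new a b k) (root new a b) x))

/-- `f₀(x) = σ^k(p_*(γ_k(x₀, x)))`, with `k` the first stage at which `x` is a vertex. -/
noncomputable def f₀ {𝒱 : Type*} {d : ℕ} (hd : 3 ≤ d) (new : Naming 𝒱 d) (a b : 𝒱)
    (x : 𝒱) : FreeGroup (Fin d) :=
  stageImage hd new a b (sInf {k : ℕ | x ∈ (T hd new a b k).verts}) x

/-! ### The words `σ^n(1)` converge to `ω` -/

lemma sigmaLetter_length_pos {d : ℕ} (hd : 3 ≤ d) (k : Fin d) :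
    1 ≤ (sigmaLetter hd k).length := by
  unfold sigmaLetter; split_ifs <;> simp

lemma length_sigmaWord {d : ℕ} (hd : 3 ≤ d) (w : List (Fin d)) :
    w.length ≤ (sigmaWord hd w).length := by
  induction w with
  | nil => simp
  | cons k w ih =>
    have := sigmaLetter_length_pos hd k
    simp only [sigmaWord, List.flatMap_cons, List.length_append, List.length_cons] at *
    omega

lemma iterate_step {d : ℕ} (hd : 3 ≤ d) (n : ℕ) :
    ∃ v : List (Fin d), v ≠ [] ∧ (sigmaWord hd)^[n + 1] [letter1 hd] =
      (sigmaWord hd)^[n] [letter1 hd] ++ v := by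
  induction n with
  | zero => exact ⟨[letter2 hd], by simp, by simp [sigmaWord, sigmaLetter, letter1]⟩
  | succ n ih =>
    obtain ⟨v, hv, h⟩ := ih
    refine ⟨sigmaWord hd v, ?_, ?_⟩
    · have := length_sigmaWord hd v
      have := List.length_pos_of_ne_nil hv
      exact List.ne_nil_of_length_pos (by omega)
    · rw [Function.iterate_succ_apply', h]
      simp only [sigmaWord, List.flatMap_append]
      rw [← h, Function.iterate_succ_apply']
      simp only [sigmaWord]

/-- `σ^n(1)` has more than `n` letters. -/
lemma length_iterate {d : ℕ} (hd : 3 ≤ d) (n : ℕ) :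
    n < ((sigmaWord hd)^[n] [letter1 hd]).length := by
  induction n with
  | zero => simp
  | succ n ih =>
    obtain ⟨v, hv, h⟩ := iterate_step hd n
    have := List.length_pos_of_ne_nil hv
    rw [h, List.length_append]; omega

lemma iterate_prefix {d : ℕ} (hd : 3 ≤ d) {m n : ℕ} (h : m ≤ n) :
    (sigmaWord hd)^[m] [letter1 hd] <+: (sigmaWord hd)^[n] [letter1 hd] := by
  induction n, h using Nat.le_induction with
  | base => exact List.prefix_rfl
  | succ n _ ih =>
    obtain ⟨v, -, h⟩ := iterate_step hd n
    exact ih.trans ⟨v, h.symm⟩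

/-- Every `σ^n(1)` is a prefix of `ω`. -/
lemma iterate_prefix_omega {d : ℕ} (hd : 3 ≤ d) (n i : ℕ)
    (hi : i < ((sigmaWord hd)^[n] [letter1 hd]).length) :
    ((sigmaWord hd)^[n] [letter1 hd])[i] = (omega hd).get i := by
  have hi' := length_iterate hd i
  change _ = ((sigmaWord hd)^[i] [letter1 hd]).getD i (letter1 hd)
  rw [List.getD_eq_getElem _ _ hi']
  rcases le_total n i with h | h
  · exact (iterate_prefix hd h).getElem hi
  · exact ((iterate_prefix hd h).getElem hi').symm

end TreeSubst

/-! Only colour 2 branches, and any other step of `τ` lowers `delay` by one, so an edge of colour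
`c` in `stage m` branches at stage `m + delay c`. The branch points are exactly the centres of the
stars (`mem_W`). The `d` edges issued from a centre born at stage `k` branch one at each of the
stages `k + d - 1, …, k + 2d - 2`. Hence for `m ≥ 1` the centres born at stage `m` correspond to
those born at the stages `k` with `m + 2 - 2d ≤ k ≤ m + 1 - d` (`born_of_edge`,
`exists_edge_of_born`, `edge_unique`).

The values of `f₀` come from a potential: each edge gets a weight in `F_d`, and replacing `(x, y,
2)` by `x ← z → y` keeps the total increment, since the two new edges weigh `σ^m(2)` and
`σ^(m+1)(2)`. So `f₀` depends neither on the stage nor on the path, and a centre `z` created at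
stage `m` satisfies `f₀(z) = f₀(x) σ^m(2)⁻¹` (`f₀_center`).

If `f₀(x)` is the inverse of the prefix of length `i`, then `f₀(z)` is the inverse of `σ^m(2)`
followed by that prefix. For `m ≥ d - 1` one has `σ^m(2) = σ^(m-d+1)(1)`, and for the `i` that occur
the product is again a prefix of `ω` (`wordOne_append_pre`). Stage `m` thus translates the lengths
in `[count (m+2-2d), count (m+2-d))` by `|σ^m(2)|`, onto `[count m, count (m+1))` (`count_eq`,
`count_succ`). These intervals tile `ℕ`, and induction on the stage of birth gives the first
bijection (`Born.f₀_eq`, `exists_born`, `born_injective`).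

The second bijection needs in addition that the shifts of `ω` are distinct: `ω` is not ultimately
periodic, because desubstituting shortens a period (`not_periodic`). -/

namespace TreeSubst

/-! ### Combinatorics of `ω`: prefixes, counting, aperiodicity, positive words. -/

section Words

variable {d : ℕ} (hd : 3 ≤ d)

/-! ### The words `σ^j(2)` and the prefixes of `ω` -/

/-- The word `σ^j(2)`. -/
def wordTwo (j : ℕ) : List (Fin d) := (sigmaWord hd)^[j] [letter2 hd]

/-- The word `σ^m(1)`. -/
def wordOne (m : ℕ) : List (Fin d) := (sigmaWord hd)^[m] [letter1 hd]

/-- The prefix of `ω` of length `i`. -/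
def pre (i : ℕ) : List (Fin d) := (omega hd).take i

lemma sigmaWord_append (u v : List (Fin d)) :
    sigmaWord hd (u ++ v) = sigmaWord hd u ++ sigmaWord hd v := by
  simp [sigmaWord]

lemma iterate_sigmaWord_append (n : ℕ) (u v : List (Fin d)) :
    (sigmaWord hd)^[n] (u ++ v) = (sigmaWord hd)^[n] u ++ (sigmaWord hd)^[n] v := by
  induction n generalizing u v with
  | zero => rfl
  | succ n ih => simp [Function.iterate_succ_apply, sigmaWord_append, ih]

lemma wordTwo_of_lt (j : ℕ) (hj : j + 1 < d) : wordTwo hd j = [⟨j + 1, hj⟩] := by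
  induction j with
  | zero => rfl
  | succ j ih =>
    rw [wordTwo, Function.iterate_succ_apply', ← wordTwo, ih (by omega)]
    simp [sigmaWord, sigmaLetter, hj]

/-- The letter `2` climbs to `d` in `d - 2` steps and then becomes `1`. This is what turns the words
`σ^j(2)` into prefixes of `ω` once `j ≥ d - 1`. -/
lemma wordTwo_add (m : ℕ) : wordTwo hd (m + (d - 1)) = wordOne hd m := by
  have h : wordTwo hd (d - 1) = [letter1 hd] := by
    obtain ⟨e, rfl⟩ : ∃ e, d = e + 2 := ⟨d - 2, by omega⟩
    change wordTwo hd (e + 1) = _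
    rw [wordTwo, Function.iterate_succ_apply', ← wordTwo, wordTwo_of_lt hd e (by omega)]
    simp [sigmaWord, sigmaLetter]
  rw [wordTwo, Function.iterate_add_apply, ← wordTwo, h, wordOne]

lemma wordOne_succ (m : ℕ) : wordOne hd (m + 1) = wordOne hd m ++ wordTwo hd m := by
  rw [wordOne, Function.iterate_succ_apply]
  exact iterate_sigmaWord_append hd m [letter1 hd] [letter2 hd]

lemma length_wordOne_succ (m : ℕ) :
    (wordOne hd (m + 1)).length = (wordOne hd m).length + (wordTwo hd m).length := by
  rw [wordOne_succ, List.length_append]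

lemma length_wordTwo_le_succ (m : ℕ) :
    (wordTwo hd m).length ≤ (wordTwo hd (m + 1)).length := by
  rw [wordTwo, wordTwo, Function.iterate_succ_apply']
  exact length_sigmaWord hd _

lemma length_wordTwo_mono {m n : ℕ} (h : m ≤ n) :
    (wordTwo hd m).length ≤ (wordTwo hd n).length :=
  monotone_nat_of_le_succ (length_wordTwo_le_succ hd) h

lemma length_wordTwo_of_lt (m : ℕ) (hm : m < d) : (wordTwo hd m).length = 1 := by
  refine le_antisymm ?_ ?_
  · have h := length_wordTwo_mono hd (show m ≤ d - 1 by omega)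
    have h' := wordTwo_add hd 0
    rw [zero_add] at h'
    rw [h'] at h
    simpa [wordOne] using h
  · simpa [wordTwo] using length_wordTwo_mono hd (Nat.zero_le m)

@[simp] lemma length_pre (i : ℕ) : (pre hd i).length = i := by simp [pre]

lemma getElem_pre (i j : ℕ) (hj : j < (pre hd i).length) :
    (pre hd i)[j] = (omega hd).get j := by
  simp [pre]

/-- The finite words that agree with `ω` are its prefixes. -/
lemma eq_pre {u : List (Fin d)} (h : ∀ i (hi : i < u.length), u[i] = (omega hd).get i) :
    u = pre hd u.length := by
  refine List.ext_getElem (by simp) fun i h1 h2 => ?_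
  rw [h i h1, getElem_pre]

lemma wordOne_eq_pre (m : ℕ) : wordOne hd m = pre hd (wordOne hd m).length :=
  eq_pre hd fun i hi => iterate_prefix_omega hd m i hi

lemma pre_prefix {i j : ℕ} (h : i ≤ j) : pre hd i <+: pre hd j := by
  rw [List.prefix_iff_eq_take]
  refine List.ext_getElem (by simp [h]) fun k h1 h2 => ?_
  simp [getElem_pre]

lemma eq_pre_of_prefix {u : List (Fin d)} {j : ℕ} (h : u <+: pre hd j) :
    u = pre hd u.length := by
  refine eq_pre hd fun i hi => ?_
  rw [h.getElem hi, getElem_pre]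

lemma isPrefix_iff (u : List (Fin d)) :
    IsPrefix u (omega hd) ↔ u = pre hd u.length := by
  constructor
  · rintro ⟨V, hV⟩
    refine eq_pre hd fun i hi => ?_
    rw [hV]
    exact (Stream'.get_append_left i u V hi).symm
  · intro h
    refine ⟨(omega hd).drop u.length, ?_⟩
    conv_rhs => rw [h]
    simp [pre, Stream'.append_take_drop]

/-! ### The numbers of branch points -/

/-- The number of branch points created by the first `m` applications of `τ`. -/
def count : ℕ → ℕ
  | 0 => 0
  | m + 1 => (wordTwo hd m).length + if m + 2 ≤ d then 0 else count (m + 2 - d)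
  decreasing_by omega

@[simp] lemma count_zero : count hd 0 = 0 := by rw [count]

lemma count_succ (m : ℕ) :
    count hd (m + 1) = (wordTwo hd m).length + count hd (m + 2 - d) := by
  rw [count]
  split_ifs with h
  · rw [show m + 2 - d = 0 by omega, count_zero]
  · rfl

/-- For `m ≥ d`, unfold the recursion twice and use `|σ^m(2)| = |σ^(m-1)(2)| + |σ^(m-d)(2)|`.
Together with `count_succ` it shows that the interval `[count m, count (m+1))` is a translate by
`|σ^m(2)|` of an earlier range of lengths. -/
lemma count_eq (m : ℕ) (hm : 1 ≤ m) :
    count hd m = (wordTwo hd m).length + count hd (m + 2 - 2 * d) := by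
  obtain ⟨k, rfl⟩ : ∃ k, m = k + 1 := ⟨m - 1, by omega⟩
  rw [count_succ]
  rcases lt_or_ge (k + 1) d with h | h
  · rw [show k + 2 - d = 0 by omega, show k + 1 + 2 - 2 * d = 0 by omega,
      length_wordTwo_of_lt hd k (by omega), length_wordTwo_of_lt hd (k + 1) h]
  · obtain ⟨l, rfl⟩ : ∃ l, k = l + (d - 1) := ⟨k - (d - 1), by omega⟩
    rw [show l + (d - 1) + 2 - d = l + 1 by omega, count_succ,
      show l + (d - 1) + 1 = l + 1 + (d - 1) by omega, wordTwo_add, wordTwo_add,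
      length_wordOne_succ, show l + 1 + (d - 1) + 2 - 2 * d = l + 2 - d by omega]
    ring

lemma count_le_succ (m : ℕ) : count hd m ≤ count hd (m + 1) := by
  induction m using Nat.strong_induction_on with
  | _ m ih =>
    rcases Nat.eq_zero_or_pos m with rfl | hm
    · simp
    · rw [count_succ, count_eq hd m hm]
      gcongr
      obtain h | h : m + 2 - 2 * d = 0 ∨ 2 * d < m + 2 := by omega
      · rw [h, count_zero]; exact Nat.zero_le _
      · have key : ∀ j, m + 2 - 2 * d + j ≤ m →
            count hd (m + 2 - 2 * d) ≤ count hd (m + 2 - 2 * d + j) := by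
          intro j
          induction j with
          | zero => simp
          | succ j ihj => exact fun hj => (ihj (by omega)).trans (ih _ (by omega))
        have := key d (by omega)
        rwa [show m + 2 - 2 * d + d = m + 2 - d by omega] at this

lemma count_mono : Monotone (count hd) := monotone_nat_of_le_succ (count_le_succ hd)

lemma lt_count (m : ℕ) : m < count hd (m + d) := by
  have h := length_iterate hd m
  rw [show m + d = m + (d - 1) + 1 by omega, count_succ, wordTwo_add]
  exact lt_of_lt_of_le h (Nat.le_add_right _ _)

/-- Every integer lies between two consecutive values of `count`. -/
lemma exists_mem_Ico_count {i m n : ℕ} (hm : count hd m ≤ i) (hn : i < count hd n) :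
    ∃ k, m ≤ k ∧ k < n ∧ i ∈ Set.Ico (count hd k) (count hd (k + 1)) := by
  induction n with
  | zero => simp at hn
  | succ n ih =>
    rcases lt_or_ge i (count hd n) with h | h
    · obtain ⟨k, h1, h2, h3⟩ := ih h
      exact ⟨k, h1, by omega, h3⟩
    · refine ⟨n, ?_, by omega, h, hn⟩
      by_contra hlt
      have := count_mono hd (show n + 1 ≤ m by omega)
      omega

/-- This bound keeps the leftover prefix in `wordOne_append_pre` short enough for
`wordOne_append_pre_of_le`. -/
lemma count_le (m : ℕ) : count hd m ≤ (wordOne hd m).length + 1 := by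
  induction m using Nat.strong_induction_on with
  | _ m ih =>
    rcases m with _ | m
    · simp
    · rw [count_succ, length_wordOne_succ]
      rcases le_or_gt (m + 2) d with h | h
      · rw [show m + 2 - d = 0 by omega, count_zero]; omega
      · have h1 := ih (m + 2 - d) (by omega)
        rw [← wordTwo_add] at h1
        have h2 := length_wordTwo_mono hd (show m + 2 - d + (d - 1) ≤ m + (d - 1) by omega)
        rw [wordTwo_add hd m] at h2
        omega

/-- Products `σ^n(1) P` that are prefixes of `ω`. -/
lemma wordOne_append_pre_of_le (n i : ℕ) (hn : d ≤ n + 1) (hi : i ≤ (wordTwo hd n).length) :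
    wordOne hd n ++ pre hd i = pre hd ((wordOne hd n).length + i) := by
  obtain ⟨l, rfl⟩ : ∃ l, n = l + (d - 1) := ⟨n - (d - 1), by omega⟩
  rw [wordTwo_add] at hi
  have h1 : pre hd i <+: wordOne hd l := by
    rw [wordOne_eq_pre hd l]; exact pre_prefix hd hi
  have h2 : wordOne hd (l + (d - 1)) ++ pre hd i <+:
      pre hd (wordOne hd (l + (d - 1) + 1)).length := by
    rw [← wordOne_eq_pre, wordOne_succ, wordTwo_add]
    exact (List.prefix_append_right_inj _).2 h1
  have := eq_pre_of_prefix hd h2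
  rwa [List.length_append, length_pre] at this

/-- A prefix no longer than `σ^n(2)` can follow `σ^n(1)`, since `σ^(n+1)(1) = σ^n(1) σ^n(2)`. By
induction, a longer one is `σ^n(2)` followed by a shorter prefix; the factor `σ^n(2)` is absorbed
into `σ^(n+1)(1)`, and the rest is at most as long as `σ^(n+1)(2)`. -/
lemma wordOne_append_pre (n i : ℕ) (hi : i < count hd (n + 1)) :
    wordOne hd n ++ pre hd i = pre hd ((wordOne hd n).length + i) := by
  induction n using Nat.strong_induction_on generalizing i with
  | _ n ih =>
    rw [count_succ] at hi
    rcases lt_or_ge (n + 1) d with h | h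
    · rw [show n + 2 - d = 0 by omega, count_zero, length_wordTwo_of_lt hd n (by omega)] at hi
      obtain rfl : i = 0 := by omega
      simpa [pre] using wordOne_eq_pre hd n
    rcases le_or_gt i (wordTwo hd n).length with h' | h'
    · exact wordOne_append_pre_of_le hd n i h h'
    obtain ⟨l, rfl⟩ : ∃ l, n = l + (d - 1) := ⟨n - (d - 1), by omega⟩
    rw [show l + (d - 1) + 2 - d = l + 1 by omega] at hi
    obtain ⟨j, rfl⟩ : ∃ j, i = (wordTwo hd (l + (d - 1))).length + j := ⟨_, (by omega :
      i = (wordTwo hd (l + (d - 1))).length + (i - (wordTwo hd (l + (d - 1))).length))⟩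
    have hj : j < count hd (l + 1) := by omega
    have h1 := ih l (by omega) j hj
    have h2 := count_le hd (l + 1)
    rw [wordTwo_add, ← h1, ← List.append_assoc]
    conv_lhs => rw [← wordTwo_add hd l, ← wordOne_succ]
    rw [wordOne_append_pre_of_le hd _ j (by omega), length_wordOne_succ, wordTwo_add]
    · congr 1; omega
    · rw [show l + (d - 1) + 1 = l + 1 + (d - 1) by omega, wordTwo_add]; omega

/-! ### The shifts of `ω` are distinct -/

lemma sigmaWord_wordOne (m : ℕ) : sigmaWord hd (wordOne hd m) = wordOne hd (m + 1) := by
  rw [wordOne, wordOne, Function.iterate_succ_apply']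

lemma sigmaWord_prefix {u v : List (Fin d)} (h : u <+: v) :
    sigmaWord hd u <+: sigmaWord hd v := by
  obtain ⟨w, rfl⟩ := h
  rw [sigmaWord_append]; exact List.prefix_append _ _

lemma sigmaWord_pre (i : ℕ) :
    sigmaWord hd (pre hd i) = pre hd (sigmaWord hd (pre hd i)).length := by
  have h1 : pre hd i <+: wordOne hd i := by
    rw [wordOne_eq_pre hd i]
    exact pre_prefix hd (length_iterate hd i).le
  have h2 := sigmaWord_prefix hd h1
  rw [sigmaWord_wordOne, wordOne_eq_pre] at h2
  exact eq_pre_of_prefix hd h2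

/-- The position in `ω = σ(ω)` at which the image of the letter of index `i` starts. -/
def cut (i : ℕ) : ℕ := (sigmaWord hd (pre hd i)).length

lemma pre_succ (i : ℕ) : pre hd (i + 1) = pre hd i ++ [(omega hd).get i] := by
  refine List.ext_getElem (by simp) fun k h1 h2 => ?_
  rw [getElem_pre, List.getElem_append]
  split_ifs with h
  · rw [getElem_pre]
  · have : k = i := by simp at h1 h; omega
    subst this; simp

lemma cut_succ (i : ℕ) : cut hd (i + 1) = cut hd i + (sigmaLetter hd ((omega hd).get i)).length := by
  simp [cut, pre_succ, sigmaWord]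

lemma get_cut_add (i j : ℕ) (hj : j < (sigmaLetter hd ((omega hd).get i)).length) :
    (omega hd).get (cut hd i + j) = (sigmaLetter hd ((omega hd).get i))[j] := by
  have h := sigmaWord_pre hd (i + 1)
  have h' : sigmaWord hd (pre hd (i + 1)) =
      sigmaWord hd (pre hd i) ++ sigmaLetter hd ((omega hd).get i) := by
    rw [pre_succ, sigmaWord_append]; simp [sigmaWord]
  rw [h'] at h
  have hl : cut hd i + j <
      (sigmaWord hd (pre hd i) ++ sigmaLetter hd ((omega hd).get i)).length := by
    rw [List.length_append]; unfold cut; omega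
  have h2 : (sigmaWord hd (pre hd i) ++ sigmaLetter hd ((omega hd).get i))[cut hd i + j]'hl =
      (omega hd).get (cut hd i + j) := by
    rw [List.getElem_of_eq h hl, getElem_pre]
  rw [← h2, List.getElem_append_right (by unfold cut; omega)]
  simp [cut]

/-- The letters of `ω` around a cut, in terms of the letter of `ω` they come from. -/
lemma cut_cases (i : ℕ) :
    (((omega hd).get i).val = 0 ∧ ((omega hd).get (cut hd i)).val = 0 ∧
      ((omega hd).get (cut hd i + 1)).val = 1 ∧ cut hd (i + 1) = cut hd i + 2) ∨
    (((omega hd).get i).val ≠ 0 ∧ ((omega hd).get (cut hd i)).val = ((omega hd).get i).val + 1 ∧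
      cut hd (i + 1) = cut hd i + 1) ∨
    (((omega hd).get i).val = d - 1 ∧ ((omega hd).get (cut hd i)).val = 0 ∧
      cut hd (i + 1) = cut hd i + 1) := by
  have h0 := get_cut_add hd i 0
  have h1 := get_cut_add hd i 1
  have h2 := cut_succ hd i
  by_cases hz : ((omega hd).get i).val = 0
  · have hs : sigmaLetter hd ((omega hd).get i) = [letter1 hd, letter2 hd] := by
      simp [sigmaLetter, hz]
    simp only [hs] at h0 h1 h2
    refine Or.inl ⟨hz, ?_, ?_, by simpa using h2⟩
    · have := h0 (by simp); simp at this; simp [this, letter1]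
    · have := h1 (by simp); simp at this; simp [this, letter2]
  by_cases hl : ((omega hd).get i).val + 1 < d
  · have hs : sigmaLetter hd ((omega hd).get i) = [⟨((omega hd).get i).val + 1, hl⟩] := by
      simp [sigmaLetter, hz, hl]
    simp only [hs] at h0 h2
    refine Or.inr (Or.inl ⟨hz, ?_, by simpa using h2⟩)
    have := h0 Nat.zero_lt_one
    rw [add_zero, List.getElem_cons_zero] at this
    rw [this]
  · have hs : sigmaLetter hd ((omega hd).get i) = [letter1 hd] := by
      simp [sigmaLetter, hz, hl]
    simp only [hs] at h0 h2
    refine Or.inr (Or.inr ⟨?_, ?_, by simpa using h2⟩)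
    · have := ((omega hd).get i).isLt; omega
    · have := h0 (by simp); simp at this; simp [this, letter1]

lemma get_cut_ne_one (i : ℕ) : ((omega hd).get (cut hd i)).val ≠ 1 := by
  rcases cut_cases hd i with h | h | h <;> omega

lemma cut_zero : cut hd 0 = 0 := by simp [cut, pre, sigmaWord]

/-- The only position inside the image of a letter that is not its start is the second letter of
`σ(1) = 12`, so the letter `2` (of value `1`) marks exactly the positions that are not cuts. -/
lemma exists_cut_of_ne_one (m : ℕ) (hm : ((omega hd).get m).val ≠ 1) :
    ∃ i, cut hd i = m := by
  have key : ∀ m, ∃ i, cut hd i = m ∨ (cut hd i + 1 = m ∧ cut hd (i + 1) = m + 1) ∧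
      ((omega hd).get m).val = 1 := by
    intro m
    induction m with
    | zero => exact ⟨0, Or.inl (cut_zero hd)⟩
    | succ m ih =>
      obtain ⟨i, h | h⟩ := ih
      · rcases cut_cases hd i with h' | h' | h'
        · exact ⟨i, Or.inr ⟨⟨by omega, by omega⟩, by rw [← h]; exact h'.2.2.1⟩⟩
        · exact ⟨i + 1, Or.inl (by omega)⟩
        · exact ⟨i + 1, Or.inl (by omega)⟩
      · exact ⟨i + 1, Or.inl (by omega)⟩
  obtain ⟨i, h | h⟩ := key m
  · exact ⟨i, h⟩
  · exact absurd h.2 hm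

/-- The letter `1` occurs in `ω` after every position. -/
lemma exists_get_eq_zero (m : ℕ) : ∃ k, ((omega hd).get (m + k)).val = 0 := by
  have h1 := length_iterate hd (m + (d - 1))
  rw [← wordOne] at h1
  obtain ⟨k, hk⟩ : ∃ k, (wordOne hd (m + (d - 1))).length = m + k :=
    ⟨(wordOne hd (m + (d - 1))).length - m, by omega⟩
  refine ⟨k, ?_⟩
  -- With `N = m + d - 1`, the prefix `σ^N(1)` is longer than `m` and is followed in `ω` by `σ^N(2)
  -- = σ^m(1)`, which starts with `1`.
  have h2 := wordOne_append_pre_of_le hd (m + (d - 1)) 1 (by omega)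
    (by rw [wordTwo_add]; have := length_iterate hd m; rw [← wordOne] at this; omega)
  have h3 : (omega hd).get (m + k) =
      (pre hd ((wordOne hd (m + (d - 1))).length + 1))[m + k]'(by simp; omega) := by
    rw [getElem_pre]
  rw [h3]
  simp only [← h2]
  rw [List.getElem_append_right (by omega), getElem_pre]
  simp only [hk, Nat.sub_self]
  rfl

/-- Desubstitution is deterministic from a cut on: a letter above `2` comes from its predecessor, a
`1` followed by `2` comes from `1`, and any other `1` comes from `d`. Both sides therefore read the
same letters and stay aligned. -/
lemma cut_add_of_eq {m n : ℕ} (h : ∀ k, (omega hd).get (cut hd m + k) = (omega hd).get (cut hd n + k))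
    (k : ℕ) : (omega hd).get (m + k) = (omega hd).get (n + k) ∧
      ∃ q, cut hd (m + k) = cut hd m + q ∧ cut hd (n + k) = cut hd n + q := by
  have step : ∀ k, (∃ q, cut hd (m + k) = cut hd m + q ∧ cut hd (n + k) = cut hd n + q) →
      (omega hd).get (m + k) = (omega hd).get (n + k) ∧
      ∃ q, cut hd (m + k + 1) = cut hd m + q ∧ cut hd (n + k + 1) = cut hd n + q := by
    rintro k ⟨q, h1, h2⟩
    have e1 := h q
    have e2 := h (q + 1)
    have o1 := get_cut_ne_one hd (m + k + 1)
    have o2 := get_cut_ne_one hd (n + k + 1)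
    rw [← add_assoc, ← add_assoc, ← h1, ← h2] at e2
    rw [← h1, ← h2] at e1
    have hz := ((omega hd).get (cut hd (n + k))).isLt
    -- When one side comes from `1` and the other from `d`, the first letters agree; the next letter
    -- is `2` on the first side and the start of an image, hence not `2`, on the other.
    rcases cut_cases hd (m + k) with a | a | a <;> rcases cut_cases hd (n + k) with b | b | b
    · exact ⟨Fin.ext (by omega), q + 2, by omega, by omega⟩
    · rw [e1] at a; omega
    · rw [← b.2.2] at e2; rw [e2] at a; omega
    · rw [e1] at a; omega
    · rw [e1] at a; exact ⟨Fin.ext (by omega), q + 1, by omega, by omega⟩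
    · rw [e1] at a; omega
    · rw [← a.2.2] at e2; rw [← e2] at b; omega
    · rw [e1] at a; omega
    · exact ⟨Fin.ext (by omega), q + 1, by omega, by omega⟩
  have all : ∀ k, ∃ q, cut hd (m + k) = cut hd m + q ∧ cut hd (n + k) = cut hd n + q := by
    intro k
    induction k with
    | zero => exact ⟨0, rfl, rfl⟩
    | succ k ih => exact (step k ih).2
  exact ⟨(step k (all k)).1, all k⟩

/-- Applying `σ` lengthens a factor by its number of letters `1`; so a factor keeps its length only
if it contains no `1`. -/
lemma cut_sub (m p : ℕ) : cut hd m + p ≤ cut hd (m + p) ∧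
    (cut hd (m + p) = cut hd m + p → ∀ k < p, ((omega hd).get (m + k)).val ≠ 0) := by
  induction p with
  | zero => simp
  | succ p ih =>
    rw [← add_assoc m p 1]
    refine ⟨?_, fun h k hk => ?_⟩
    · rcases cut_cases hd (m + p) with a | a | a <;> omega
    · rcases cut_cases hd (m + p) with a | a | a
      · omega
      all_goals
        rcases Nat.lt_succ_iff_lt_or_eq.1 hk with h' | rfl
        · exact ih.2 (by omega) k h'
        · omega

lemma cut_strictMono : StrictMono (cut hd) :=
  strictMono_nat_of_lt_succ fun i => by
    rcases cut_cases hd i with a | a | a <;> omega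

/-- `ω` is not ultimately periodic. -/
lemma not_periodic (p : ℕ) (hp : 0 < p) (m : ℕ) :
    ¬ ∀ k, (omega hd).get (m + k) = (omega hd).get (m + p + k) := by
  induction p using Nat.strong_induction_on generalizing m with
  | _ p ih =>
    intro h
    -- Starting the comparison at a letter `1` makes both positions cuts, so that the period can be
    -- desubstituted.
    obtain ⟨m', hm', h'⟩ : ∃ m', ((omega hd).get m').val ≠ 1 ∧
        ∀ k, (omega hd).get (m' + k) = (omega hd).get (m' + p + k) := by
      obtain ⟨k, hk⟩ := exists_get_eq_zero hd m
      refine ⟨m + k, by omega, fun j => ?_⟩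
      have := h (k + j)
      rw [← add_assoc, ← add_assoc] at this
      rw [this]; congr 1; omega
    have hn' : ((omega hd).get (m' + p)).val ≠ 1 := by
      have := h' 0; simp only [add_zero] at this; rwa [← this]
    obtain ⟨i, rfl⟩ := exists_cut_of_ne_one hd m' hm'
    obtain ⟨j, hj⟩ := exists_cut_of_ne_one hd _ hn'
    have hij : i < j := (cut_strictMono hd).lt_iff_lt.1 (by omega)
    obtain ⟨q, rfl⟩ := Nat.exists_eq_add_of_lt hij
    rw [add_assoc] at hj
    rw [← hj] at h'
    have hper := fun k => (cut_add_of_eq hd h' k).1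
    have hs := cut_sub hd i (q + 1)
    -- The desubstituted sequence has period `q + 1`. Either this is smaller than `p`, or a whole
    -- period contains no `1`, and then `1` never occurs again.
    rcases lt_or_eq_of_le (show q + 1 ≤ p by omega) with hq | hq
    · exact ih (q + 1) hq (by omega) i hper
    · have hno := hs.2 (by omega)
      have hall : ∀ k, ((omega hd).get (i + k)).val ≠ 0 := by
        intro k
        induction k using Nat.strong_induction_on with
        | _ k ihk =>
          rcases lt_or_ge k (q + 1) with hk | hk
          · exact hno k hk
          · obtain ⟨l, rfl⟩ := Nat.exists_eq_add_of_le hk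
            rw [← add_assoc, ← hper l]
            exact ihk l (by omega)
      obtain ⟨k, hk⟩ := exists_get_eq_zero hd i
      exact hall k hk

lemma drop_omega_injective : Function.Injective fun n => (omega hd).drop n := by
  intro m n h
  have h' : ∀ k, (omega hd).get (m + k) = (omega hd).get (n + k) := fun k => by
    have := congrArg (fun s => Stream'.get s k) h
    simpa [Stream'.get_drop, add_comm] using this
  rcases lt_trichotomy m n with hmn | hmn | hmn
  · obtain ⟨q, rfl⟩ := Nat.exists_eq_add_of_lt hmn
    exact absurd h' (not_periodic hd (q + 1) (by omega) m)
  · exact hmn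
  · obtain ⟨q, rfl⟩ := Nat.exists_eq_add_of_lt hmn
    exact absurd (fun k => (h' k).symm) (not_periodic hd (q + 1) (by omega) n)

/-! ### Positive words in the free group -/

lemma toFree_append (u v : List (Fin d)) : toFree (u ++ v) = toFree u * toFree v := by
  simp [toFree]

/-- The morphism to `ℤ` sending every generator to `1` recovers the length, which is enough to tell
prefixes of `ω` apart. -/
lemma length_eq_of_toFree_eq {u v : List (Fin d)} (h : toFree u = toFree v) :
    u.length = v.length := by
  have key : ∀ w : List (Fin d),
      FreeGroup.lift (fun _ : Fin d => Multiplicative.ofAdd (1 : ℤ)) (toFree w) =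
        Multiplicative.ofAdd (w.length : ℤ) := by
    intro w
    induction w with
    | nil => simp [toFree]
    | cons k w ih =>
      rw [← List.singleton_append, toFree_append, map_mul, ih]
      simp [toFree, ← ofAdd_add, add_comm]
  have := congrArg (FreeGroup.lift fun _ : Fin d => Multiplicative.ofAdd (1 : ℤ)) h
  rw [key, key] at this
  exact_mod_cast Multiplicative.ofAdd.injective this

lemma sigma_toFree (w : List (Fin d)) : sigma hd (toFree w) = toFree (sigmaWord hd w) := by
  induction w with
  | nil => simp [toFree, sigmaWord]
  | cons k w ih =>
    rw [← List.singleton_append, toFree_append, map_mul, ih, sigmaWord_append, toFree_append]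
    simp [toFree, sigmaWord, sigma]

lemma iterate_sigma_toFree (n : ℕ) (w : List (Fin d)) :
    (sigma hd)^[n] (toFree w) = toFree ((sigmaWord hd)^[n] w) := by
  induction n generalizing w with
  | zero => rfl
  | succ n ih => rw [Function.iterate_succ_apply, sigma_toFree, ih, Function.iterate_succ_apply]

/-- The number of applications of `τ` after which an edge of colour `c` has colour `2`. -/
def delay : Color d → ℕ
  | Sum.inl k => if k.val = 0 then d - 1 else k.val - 1
  | Sum.inr h => d + h.val

/-- Every `p_*(c)` is `σ^(delay c)(2)`, so the values of `p_*` follow the time at which an edge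
branches. -/
lemma iterate_sigma_pLetter (n : ℕ) (c : Color d) :
    (sigma hd)^[n] (pLetter hd c) = toFree (wordTwo hd (n + delay c)) := by
  have key : pLetter hd c = toFree (wordTwo hd (delay c)) := by
    rcases c with k | h
    · by_cases hk : k.val = 0
      · have := wordTwo_add hd 0
        rw [zero_add] at this
        simp only [pLetter, delay, hk, if_true, this, wordOne, toFree, Function.iterate_zero, id]
        simp [letter1, ← hk]
      · simp only [pLetter, delay, hk, if_false]
        rw [wordTwo_of_lt hd _ (by omega)]
        simp [toFree, show k.val - 1 + 1 = k.val by omega]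
    · have : (FreeGroup.of (letter1 hd)) = toFree [letter1 hd] := by simp [toFree]
      simp only [pLetter, delay]
      rw [show d + h.val = h.val + 1 + (d - 1) by omega, wordTwo_add, this, iterate_sigma_toFree,
        wordOne]
  rw [key, iterate_sigma_toFree, wordTwo, wordTwo, ← Function.iterate_add_apply]

end Words

end TreeSubst

namespace TreeSubst

/-! ### Structure of the trees: new vertices, degrees, birth of branch points. -/

section Graphs

variable {𝒱 : Type*} {d : ℕ} (hd : 3 ≤ d) (new : Naming 𝒱 d) (a b : 𝒱)

/-! ### The trees `τ^m(X_2)` -/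

/-- The tree `τ^m(X_2)`. -/
noncomputable def stage (m : ℕ) : ColoredGraph 𝒱 (Color d) := (tau hd new)^[m] (X₂ hd a b)

lemma T_eq_stage (n : ℕ) : T hd new a b n = stage hd new a b (n + (d - 1)) := by
  rw [T, stage, Function.iterate_add_apply]

lemma stage_succ (m : ℕ) : stage hd new a b (m + 1) = tau hd new (stage hd new a b m) := by
  rw [stage, Function.iterate_succ_apply', stage]

/-- The colour `2`. -/
abbrev colorTwo : Color d := Sum.inl (letter2 hd)

lemma mem_edges_zero {u v : 𝒱} {c : Color d} :
    (u, v, c) ∈ (stage hd new a b 0).edges ↔ u = a ∧ v = b ∧ c = colorTwo hd := by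
  simp [stage, X₂, edgeGraph]

lemma mem_edges_succ {m : ℕ} {u v : 𝒱} {c' : Color d} :
    (u, v, c') ∈ (stage hd new a b (m + 1)).edges ↔
      (∃ c, c ≠ colorTwo hd ∧ (u, v, c) ∈ (stage hd new a b m).edges ∧ c' = recolor hd c) ∨
      ∃ x y, (x, y, colorTwo hd) ∈ (stage hd new a b m).edges ∧ u = new x y none ∧
        ((v = x ∧ c' = Sum.inl (letterD hd)) ∨ (v = y ∧ c' = Sum.inl (letter1 hd)) ∨
          ∃ h, v = new x y (some h) ∧ c' = Sum.inr h) := by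
  rw [stage_succ]
  simp only [tau, Set.mem_iUnion, exists_prop, Prod.exists]
  constructor
  · rintro ⟨x, y, c, he, h⟩
    by_cases hc : c = colorTwo hd
    · subst hc
      simp only [tauEdge, if_true, Set.mem_union, Set.mem_insert_iff, Set.mem_singleton_iff,
        Set.mem_range, Prod.mk.injEq] at h
      refine Or.inr ⟨x, y, he, ?_⟩
      rcases h with (⟨h1, h2, h3⟩ | ⟨h1, h2, h3⟩) | ⟨k, h1, h2, h3⟩
      · exact ⟨h1, Or.inl ⟨h2, h3⟩⟩
      · exact ⟨h1, Or.inr (Or.inl ⟨h2, h3⟩)⟩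
      · exact ⟨h1.symm, Or.inr (Or.inr ⟨k, h2.symm, h3.symm⟩)⟩
    · simp only [tauEdge, if_neg hc, edgeGraph, Set.mem_singleton_iff, Prod.mk.injEq] at h
      obtain ⟨rfl, rfl, rfl⟩ := h
      exact Or.inl ⟨c, hc, he, rfl⟩
  · rintro (⟨c, hc, he, rfl⟩ | ⟨x, y, he, rfl, h⟩)
    · refine ⟨u, v, c, he, ?_⟩
      simp [tauEdge, if_neg hc, edgeGraph]
    · refine ⟨x, y, _, he, ?_⟩
      simp only [tauEdge, if_true, Set.mem_union, Set.mem_insert_iff, Set.mem_singleton_iff,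
        Set.mem_range, Prod.mk.injEq]
      rcases h with ⟨h2, h3⟩ | ⟨h2, h3⟩ | ⟨k, h2, h3⟩
      · exact Or.inl (Or.inl ⟨trivial, h2, h3⟩)
      · exact Or.inl (Or.inr ⟨trivial, h2, h3⟩)
      · exact Or.inr ⟨k, trivial, h2.symm, h3.symm⟩

lemma mem_verts_succ {m : ℕ} {v : 𝒱} :
    v ∈ (stage hd new a b (m + 1)).verts ↔
      (∃ x y c, (x, y, c) ∈ (stage hd new a b m).edges ∧ (v = x ∨ v = y)) ∨
      ∃ x y i, (x, y, colorTwo hd) ∈ (stage hd new a b m).edges ∧ v = new x y i := by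
  rw [stage_succ]
  simp only [tau, Set.mem_iUnion, exists_prop, Prod.exists]
  constructor
  · rintro ⟨x, y, c, he, h⟩
    by_cases hc : c = colorTwo hd
    · subst hc
      simp only [tauEdge, if_true, Set.mem_union, Set.mem_insert_iff, Set.mem_singleton_iff,
        Set.mem_range] at h
      rcases h with h | ⟨i, rfl⟩
      · exact Or.inl ⟨x, y, _, he, h⟩
      · exact Or.inr ⟨x, y, i, he, rfl⟩
    · simp only [tauEdge, if_neg hc, edgeGraph, Set.mem_insert_iff, Set.mem_singleton_iff] at h
      exact Or.inl ⟨x, y, c, he, h⟩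
  · rintro (⟨x, y, c, he, h⟩ | ⟨x, y, i, he, rfl⟩)
    · refine ⟨x, y, c, he, ?_⟩
      by_cases hc : c = colorTwo hd
      · subst hc
        simp [tauEdge, h]
      · simpa [tauEdge, if_neg hc, edgeGraph] using h
    · exact ⟨x, y, _, he, by simp [tauEdge]⟩

/-- The vertices of `τ^m(X_2)` are the ends of its edges. -/
lemma mem_verts {m : ℕ} {v : 𝒱} : v ∈ (stage hd new a b m).verts ↔
    ∃ x y c, (x, y, c) ∈ (stage hd new a b m).edges ∧ (v = x ∨ v = y) := by
  rcases m with _ | m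
  · simp only [mem_edges_zero]
    constructor
    · intro h
      exact ⟨a, b, _, ⟨rfl, rfl, rfl⟩, h⟩
    · rintro ⟨x, y, c, ⟨rfl, rfl, rfl⟩, h⟩
      exact h
  · rw [mem_verts_succ]
    simp only [mem_edges_succ]
    constructor
    · rintro (⟨x, y, c, he, h⟩ | ⟨x, y, i, he, rfl⟩)
      · by_cases hc : c = colorTwo hd
        · subst hc
          rcases h with rfl | rfl
          · exact ⟨_, _, _, Or.inr ⟨v, y, he, rfl, Or.inl ⟨rfl, rfl⟩⟩, Or.inr rfl⟩
          · exact ⟨_, _, _, Or.inr ⟨x, v, he, rfl, Or.inr (Or.inl ⟨rfl, rfl⟩)⟩, Or.inr rfl⟩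
        · exact ⟨_, _, _, Or.inl ⟨c, hc, he, rfl⟩, h⟩
      · rcases i with _ | k
        · exact ⟨_, _, _, Or.inr ⟨x, y, he, rfl, Or.inl ⟨rfl, rfl⟩⟩, Or.inl rfl⟩
        · exact ⟨_, _, _, Or.inr ⟨x, y, he, rfl, Or.inr (Or.inr ⟨k, rfl, rfl⟩)⟩, Or.inr rfl⟩
    · rintro ⟨x, y, c', ⟨c, hc, he, rfl⟩ | ⟨x', y', he, rfl, h⟩, hv⟩
      · exact Or.inl ⟨x, y, c, he, hv⟩
      · rcases hv with rfl | rfl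
        · exact Or.inr ⟨x', y', none, he, rfl⟩
        · rcases h with ⟨rfl, -⟩ | ⟨rfl, -⟩ | ⟨k, rfl, -⟩
          · exact Or.inl ⟨_, _, _, he, Or.inl rfl⟩
          · exact Or.inl ⟨_, _, _, he, Or.inr rfl⟩
          · exact Or.inr ⟨_, _, _, he, rfl⟩

lemma left_mem_verts {m : ℕ} {x y : 𝒱} {c : Color d}
    (h : (x, y, c) ∈ (stage hd new a b m).edges) : x ∈ (stage hd new a b m).verts :=
  (mem_verts hd new a b).2 ⟨x, y, c, h, Or.inl rfl⟩

lemma right_mem_verts {m : ℕ} {x y : 𝒱} {c : Color d}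
    (h : (x, y, c) ∈ (stage hd new a b m).edges) : y ∈ (stage hd new a b m).verts :=
  (mem_verts hd new a b).2 ⟨x, y, c, h, Or.inr rfl⟩

lemma verts_subset_succ {m : ℕ} :
    (stage hd new a b m).verts ⊆ (stage hd new a b (m + 1)).verts := fun _ hv =>
  (mem_verts_succ hd new a b).2 (Or.inl ((mem_verts hd new a b).1 hv))

lemma verts_mono : Monotone fun m => (stage hd new a b m).verts :=
  monotone_nat_of_le_succ fun _ => verts_subset_succ hd new a b

lemma root_mem_verts {m : ℕ} (hm : 1 ≤ m) : root new a b ∈ (stage hd new a b m).verts :=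
  verts_mono hd new a b hm ((mem_verts_succ hd new a b).2 (Or.inr ⟨a, b, none,
    (mem_edges_zero hd new a b).2 ⟨rfl, rfl, rfl⟩, rfl⟩))

variable {a b new}

lemma edge_ne (hτ : IsTreeSubstitution hd new a b)
    {m : ℕ} {x y : 𝒱} {c : Color d} (h : (x, y, c) ∈ (stage hd new a b m).edges) :
    x ≠ y := by
  induction m generalizing x y c with
  | zero =>
    obtain ⟨rfl, rfl, -⟩ := (mem_edges_zero hd new a b).1 h
    exact hτ.ne
  | succ m ih =>
    rcases (mem_edges_succ hd new a b).1 h with ⟨c, -, he, -⟩ | ⟨x', y', he, rfl, hs⟩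
    · exact ih he
    · have hne := ih he
      rcases hs with ⟨rfl, -⟩ | ⟨rfl, -⟩ | ⟨k, rfl, -⟩
      · exact (hτ.ne_ends _ _ hne none).1
      · exact (hτ.ne_ends _ _ hne none).2
      · exact (hτ.injective _ _ hne).ne (by simp)

lemma new_notMem_tauEdge (hτ : IsTreeSubstitution hd new a b)
    {m : ℕ} {x y : 𝒱} {e : 𝒱 × 𝒱 × Color d} (i : Option (Fin (d - 2)))
    (h : (x, y, colorTwo hd) ∈ (stage hd new a b m).edges)
    (he : e ∈ (stage hd new a b m).edges) (hne : (x, y, colorTwo hd) ≠ e) :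
    new x y i ∉ (tauEdge hd new e).verts := by
  refine Set.disjoint_left.1 (hτ.disjoint m _ h _ he hne) ⟨by simp [tauEdge], ?_⟩
  have := hτ.ne_ends x y (edge_ne hd hτ h) i
  simp [this.1, this.2]

/-- The vertices created at different places are different. -/
lemma new_inj (hτ : IsTreeSubstitution hd new a b)
    {m : ℕ} {x y x' y' : 𝒱} {i i' : Option (Fin (d - 2))}
    (h : (x, y, colorTwo hd) ∈ (stage hd new a b m).edges)
    (h' : (x', y', colorTwo hd) ∈ (stage hd new a b m).edges)
    (heq : new x y i = new x' y' i') : x = x' ∧ y = y' ∧ i = i' := by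
  by_cases hne : (x, y, colorTwo hd) = (x', y', colorTwo hd)
  · simp only [Prod.mk.injEq, and_true] at hne
    obtain ⟨rfl, rfl⟩ := hne
    exact ⟨rfl, rfl, hτ.injective _ _ (edge_ne hd hτ h) heq⟩
  · exact absurd (by rw [heq]; simp [tauEdge]) (new_notMem_tauEdge hd hτ i h h' hne)

lemma new_notMem_verts (hτ : IsTreeSubstitution hd new a b)
    {m : ℕ} {x y : 𝒱} (i : Option (Fin (d - 2)))
    (h : (x, y, colorTwo hd) ∈ (stage hd new a b m).edges) :
    new x y i ∉ (stage hd new a b m).verts := by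
  intro hv
  obtain ⟨x', y', c, he, hv⟩ := (mem_verts hd new a b).1 hv
  by_cases hne : (x, y, colorTwo hd) = (x', y', c)
  · simp only [Prod.mk.injEq] at hne
    obtain ⟨rfl, rfl, rfl⟩ := hne
    have := hτ.ne_ends _ _ (edge_ne hd hτ h) i
    tauto
  · refine new_notMem_tauEdge hd hτ i h he hne ?_
    by_cases hc : c = colorTwo hd
    · subst hc
      rcases hv with hv | hv <;> simp [tauEdge, hv]
    · simpa [tauEdge, if_neg hc, edgeGraph] using hv

/-! ### Delays -/

lemma delay_eq_zero {c : Color d} : delay c = 0 ↔ c = colorTwo hd := by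
  rcases c with k | h
  · simp only [delay, colorTwo, letter2, Sum.inl.injEq, Fin.ext_iff]
    split_ifs <;> omega
  · simp [delay]; omega

lemma delay_colorTwo : delay (colorTwo hd) = 0 := (delay_eq_zero hd).2 rfl

lemma delay_recolor {c : Color d} (hc : c ≠ colorTwo hd) : delay (recolor hd c) + 1 = delay c := by
  have h0 : delay c ≠ 0 := fun h => hc ((delay_eq_zero hd).1 h)
  rcases c with k | h
  · have := k.isLt
    by_cases hk : k.val = 0
    · simp only [recolor, hk, delay, letterD, if_true]
      rw [if_neg (by omega)]; omega
    · simp only [delay, hk, if_false] at h0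
      simp only [recolor, hk, delay, if_false]
      rw [if_neg (by omega)]; omega
  · by_cases hk : h.val = 0
    · simp only [recolor, hk, delay, letter1, if_true]; omega
    · simp only [recolor, hk, delay, if_false]; omega

lemma delay_injective : Function.Injective (delay : Color d → ℕ) := by
  rintro (k | h) (k' | h') heq <;> simp only [delay] at heq
  · congr 1; ext; split_ifs at heq <;> omega
  · split_ifs at heq <;> omega
  · split_ifs at heq <;> omega
  · congr 1; ext; omega

lemma recolor_inj {c c' : Color d} (hc : c ≠ colorTwo hd) (hc' : c' ≠ colorTwo hd)
    (h : recolor hd c = recolor hd c') : c = c' := by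
  apply delay_injective
  rw [← delay_recolor hd hc, ← delay_recolor hd hc', h]

lemma delay_letterD : delay (Sum.inl (letterD hd)) = d - 2 := by
  have : (letterD hd).val ≠ 0 := by simp only [letterD]; omega
  simp only [delay, if_neg this]
  simp only [letterD]; omega

lemma delay_letter1 : delay (Sum.inl (letter1 hd)) = d - 1 := by
  simp [delay, letter1]

/-! ### Degrees -/

/-- The vertex `z` is the centre of a star created by the passage from `τ^m(X_2)` to
`τ^(m+1)(X_2)`. -/
def Born (new : Naming 𝒱 d) (a b : 𝒱) (m : ℕ) (z : 𝒱) : Prop :=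
  ∃ x y, (x, y, colorTwo hd) ∈ (stage hd new a b m).edges ∧ z = new x y none

/-- The edges of `τ^m(X_2)` at a vertex. -/
def star (new : Naming 𝒱 d) (a b : 𝒱) (m : ℕ) (v : 𝒱) : Set (𝒱 × 𝒱 × Color d) :=
  {e ∈ (stage hd new a b m).edges | e.1 = v ∨ e.2.1 = v}

/-- Each edge at an old vertex is replaced by exactly one edge at that vertex, so degrees are fixed
from the creation of a vertex on. -/
lemma encard_star_succ (hτ : IsTreeSubstitution hd new a b)
    {m : ℕ} {v : 𝒱} (hv : v ∈ (stage hd new a b m).verts) :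
    (star hd new a b (m + 1) v).encard = (star hd new a b m v).encard := by
  classical
  -- `φ` sends an edge at `v` to the edge at `v` in its image: for colour 2, the half of `x ← z → y`
  -- that contains `v`.
  let φ : 𝒱 × 𝒱 × Color d → 𝒱 × 𝒱 × Color d := fun e =>
    if e.2.2 = colorTwo hd then
      if e.1 = v then (new e.1 e.2.1 none, e.1, Sum.inl (letterD hd))
      else (new e.1 e.2.1 none, e.2.1, Sum.inl (letter1 hd))
    else (e.1, e.2.1, recolor hd e.2.2)
  have himage : star hd new a b (m + 1) v = φ '' star hd new a b m v := by
    ext ⟨u, w, c'⟩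
    simp only [star, Set.mem_ofPred_eq, Set.mem_image, Prod.exists]
    constructor
    · rintro ⟨hs, hv'⟩
      rcases (mem_edges_succ hd new a b).1 hs with ⟨c, hc, he, rfl⟩ | ⟨x, y, he, rfl, h⟩
      · exact ⟨u, w, c, ⟨he, hv'⟩, by simp [φ, hc]⟩
      · have h1 : new x y none ≠ v := fun h => new_notMem_verts hd hτ none he (h ▸ hv)
        replace hv' := hv'.resolve_left h1
        rcases h with ⟨rfl, rfl⟩ | ⟨rfl, rfl⟩ | ⟨k, rfl, rfl⟩
        · exact ⟨w, y, _, ⟨he, Or.inl hv'⟩, by simp [φ, show w = v from hv']⟩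
        · refine ⟨x, w, _, ⟨he, Or.inr hv'⟩, ?_⟩
          have := edge_ne hd hτ he
          have hw : w = v := hv'
          simp [φ, show x ≠ v from fun h => this (h.trans hw.symm)]
        · exact absurd (hv' ▸ hv) (new_notMem_verts hd hτ _ he)
    · rintro ⟨x, y, c, ⟨he, hv'⟩, heq⟩
      by_cases hc : c = colorTwo hd
      · subst hc
        by_cases hx : x = v
        · simp only [φ, if_true, hx, Prod.mk.injEq] at heq
          obtain ⟨rfl, rfl, rfl⟩ := heq
          subst hx
          exact ⟨(mem_edges_succ hd new a b).2 (Or.inr ⟨x, y, he, rfl, Or.inl ⟨rfl, rfl⟩⟩),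
            Or.inr rfl⟩
        · simp only [φ, if_true, hx, if_false, Prod.mk.injEq] at heq
          obtain ⟨rfl, rfl, rfl⟩ := heq
          exact ⟨(mem_edges_succ hd new a b).2 (Or.inr ⟨x, y, he, rfl, Or.inr (Or.inl ⟨rfl, rfl⟩)⟩),
            Or.inr (hv'.resolve_left hx)⟩
      · simp only [φ, hc, if_false, Prod.mk.injEq] at heq
        obtain ⟨rfl, rfl, rfl⟩ := heq
        exact ⟨(mem_edges_succ hd new a b).2 (Or.inl ⟨c, hc, he, rfl⟩), hv'⟩
  have hinj : Set.InjOn φ (star hd new a b m v) := by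
    rintro ⟨x, y, c⟩ ⟨he, -⟩ ⟨x', y', c'⟩ ⟨he', -⟩ heq
    by_cases hc : c = colorTwo hd <;> by_cases hc' : c' = colorTwo hd
    · subst hc hc'
      have h1 : new x y none = new x' y' none := by
        have := congrArg Prod.fst heq
        simp only [φ, if_true] at this
        split_ifs at this <;> exact this
      obtain ⟨rfl, rfl, -⟩ := new_inj hd hτ he he' h1
      rfl
    · subst hc
      have h1 : new x y none = x' := by
        have := congrArg Prod.fst heq
        simp only [φ, if_true, hc', if_false] at this
        split_ifs at this <;> exact this
      exact absurd (h1 ▸ left_mem_verts hd new a b he') (new_notMem_verts hd hτ none he)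
    · subst hc'
      have h1 : x = new x' y' none := by
        have := congrArg Prod.fst heq
        simp only [φ, if_true, hc, if_false] at this
        split_ifs at this <;> exact this
      exact absurd (h1 ▸ left_mem_verts hd new a b he) (new_notMem_verts hd hτ none he')
    · simp only [φ, hc, hc', if_false, Prod.mk.injEq] at heq
      obtain ⟨rfl, rfl, h⟩ := heq
      rw [recolor_inj hd hc hc' h]
  rw [himage, hinj.encard_image]

lemma encard_star_center (hτ : IsTreeSubstitution hd new a b)
    {m : ℕ} {z : 𝒱} (hz : Born hd new a b m z) :
    (star hd new a b (m + 1) z).encard = d := by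
  obtain ⟨x, y, he, rfl⟩ := hz
  have hxy := edge_ne hd hτ he
  have hnot := fun i => new_notMem_verts hd hτ i he
  let g : Option (Option (Fin (d - 2))) → 𝒱 × 𝒱 × Color d := fun i => match i with
    | none => (new x y none, x, Sum.inl (letterD hd))
    | some none => (new x y none, y, Sum.inl (letter1 hd))
    | some (some k) => (new x y none, new x y (some k), Sum.inr k)
  have hS : star hd new a b (m + 1) (new x y none) = Set.range g := by
    ext ⟨u, w, c'⟩
    simp only [star, Set.mem_ofPred_eq, mem_edges_succ, Set.mem_range]
    constructor
    · rintro ⟨⟨c, hc, he', rfl⟩ | ⟨x', y', he', rfl, h⟩, hv⟩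
      · rcases hv with rfl | rfl
        · exact absurd (left_mem_verts hd new a b he') (hnot _)
        · exact absurd (right_mem_verts hd new a b he') (hnot _)
      · have hh : x' = x ∧ y' = y := by
          rcases hv with hv | hv
          · obtain ⟨h1, h2, -⟩ := new_inj hd hτ he' he hv
            exact ⟨h1, h2⟩
          · rcases h with ⟨rfl, -⟩ | ⟨rfl, -⟩ | ⟨k, rfl, -⟩
            · exact absurd (hv ▸ left_mem_verts hd new a b he') (hnot _)
            · exact absurd (hv ▸ right_mem_verts hd new a b he') (hnot _)
            · obtain ⟨h1, h2, -⟩ := new_inj hd hτ he' he hv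
              exact ⟨h1, h2⟩
        obtain ⟨rfl, rfl⟩ := hh
        rcases h with ⟨rfl, rfl⟩ | ⟨rfl, rfl⟩ | ⟨k, rfl, rfl⟩
        · exact ⟨none, rfl⟩
        · exact ⟨some none, rfl⟩
        · exact ⟨some (some k), rfl⟩
    · rintro ⟨i, hi⟩
      rcases i with _ | _ | k <;> simp only [g, Prod.mk.injEq] at hi <;>
        obtain ⟨rfl, rfl, rfl⟩ := hi
      · exact ⟨Or.inr ⟨x, y, he, rfl, Or.inl ⟨rfl, rfl⟩⟩, Or.inl rfl⟩
      · exact ⟨Or.inr ⟨x, y, he, rfl, Or.inr (Or.inl ⟨rfl, rfl⟩)⟩, Or.inl rfl⟩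
      · exact ⟨Or.inr ⟨x, y, he, rfl, Or.inr (Or.inr ⟨k, rfl, rfl⟩)⟩, Or.inl rfl⟩
  have hg : Function.Injective g := by
    intro i j hij
    have h1 : letterD hd ≠ letter1 hd := by simp [letterD, letter1]; omega
    rcases i with _ | _ | k <;> rcases j with _ | _ | l <;>
      simp_all [g, Ne.symm h1]
  rw [hS, ← Set.image_univ, hg.injOn.encard_image, Set.encard_univ,
    ENat.card_eq_coe_fintype_card, Fintype.card_option, Fintype.card_option, Fintype.card_fin]
  congr 1
  omega

lemma encard_star_leaf (hτ : IsTreeSubstitution hd new a b) {m : ℕ} {x y : 𝒱} (k : Fin (d - 2))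
    (he : (x, y, colorTwo hd) ∈ (stage hd new a b m).edges) :
    (star hd new a b (m + 1) (new x y (some k))).encard = 1 := by
  have hnot := fun i => new_notMem_verts hd hτ i he
  have hS : star hd new a b (m + 1) (new x y (some k)) =
      {(new x y none, new x y (some k), Sum.inr k)} := by
    ext ⟨u, w, c'⟩
    simp only [star, Set.mem_ofPred_eq, mem_edges_succ, Set.mem_singleton_iff, Prod.mk.injEq]
    constructor
    · rintro ⟨⟨c, hc, he', rfl⟩ | ⟨x', y', he', rfl, h⟩, hv⟩
      · rcases hv with rfl | rfl
        · exact absurd (left_mem_verts hd new a b he') (hnot _)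
        · exact absurd (right_mem_verts hd new a b he') (hnot _)
      · rcases hv with hv | hv
        · exact absurd (new_inj hd hτ he' he hv).2.2 (by simp)
        · rcases h with ⟨rfl, -⟩ | ⟨rfl, -⟩ | ⟨l, rfl, rfl⟩
          · exact absurd (hv ▸ left_mem_verts hd new a b he') (hnot _)
          · exact absurd (hv ▸ right_mem_verts hd new a b he') (hnot _)
          · obtain ⟨rfl, rfl, h⟩ := new_inj hd hτ he' he hv
            obtain rfl := Option.some_injective _ h
            exact ⟨rfl, rfl, rfl⟩
    · rintro ⟨rfl, rfl, rfl⟩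
      exact ⟨Or.inr ⟨x, y, he, rfl, Or.inr (Or.inr ⟨k, rfl, rfl⟩)⟩, Or.inr rfl⟩
  rw [hS, Set.encard_singleton]

lemma Born.mem_verts {m : ℕ} {z : 𝒱} (hz : Born hd new a b m z) {n : ℕ} (hn : m < n) :
    z ∈ (stage hd new a b n).verts := by
  obtain ⟨x, y, he, rfl⟩ := hz
  exact verts_mono hd new a b hn ((mem_verts_succ hd new a b).2 (Or.inr ⟨x, y, none, he, rfl⟩))

lemma encard_star_of_born (hτ : IsTreeSubstitution hd new a b)
    {m : ℕ} {z : 𝒱} (hz : Born hd new a b m z) {n : ℕ} (hn : m < n) :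
    (star hd new a b n z).encard = d := by
  induction n, hn using Nat.le_induction with
  | base => exact encard_star_center hd hτ hz
  | succ n hn ih => rw [encard_star_succ hd hτ (hz.mem_verts hd hn), ih]

lemma born_or_encard_star (hτ : IsTreeSubstitution hd new a b)
    {m : ℕ} {v : 𝒱} (hv : v ∈ (stage hd new a b m).verts) :
    (∃ k < m, Born hd new a b k v) ∨ (star hd new a b m v).encard = 1 := by
  induction m with
  | zero =>
    refine Or.inr ?_
    obtain ⟨x, y, c, he, h⟩ := (TreeSubst.mem_verts hd new a b).1 hv
    obtain ⟨rfl, rfl, rfl⟩ := (mem_edges_zero hd new a b).1 he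
    rw [Set.encard_eq_one]
    refine ⟨(x, y, colorTwo hd), ?_⟩
    ext ⟨u, w, c⟩
    simp only [star, Set.mem_ofPred_eq, mem_edges_zero, Set.mem_singleton_iff, Prod.mk.injEq]
    constructor
    · exact fun h => h.1
    · rintro ⟨rfl, rfl, rfl⟩
      exact ⟨⟨rfl, rfl, rfl⟩, by rcases h with rfl | rfl <;> simp⟩
  | succ m ih =>
    by_cases hm : v ∈ (stage hd new a b m).verts
    · rcases ih hm with ⟨k, hk, h⟩ | h
      · exact Or.inl ⟨k, by omega, h⟩
      · exact Or.inr (by rw [encard_star_succ hd hτ hm, h])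
    · rcases (mem_verts_succ hd new a b).1 hv with h | ⟨x, y, i, he, rfl⟩
      · exact absurd ((TreeSubst.mem_verts hd new a b).2 h) hm
      · rcases i with _ | k
        · exact Or.inl ⟨m, by omega, x, y, he, rfl⟩
        · exact Or.inr (encard_star_leaf hd hτ k he)

/-- The branch points of `T_n^s` are the centres of the stars. -/
lemma mem_W (hτ : IsTreeSubstitution hd new a b) {n : ℕ} {v : 𝒱} :
    v ∈ W hd new a b n ↔ ∃ k < n + (d - 1), Born hd new a b k v := by
  rw [W, T_eq_stage]
  constructor
  · rintro ⟨h1, h2⟩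
    refine (born_or_encard_star hd hτ h1).resolve_right fun h => ?_
    change (star hd new a b (n + (d - 1)) v).encard = d at h2
    rw [h2] at h
    have : d = 1 := by exact_mod_cast h
    omega
  · rintro ⟨k, hk, h⟩
    exact ⟨h.mem_verts hd hk, encard_star_of_born hd hτ h hk⟩

lemma mem_iUnion_W (hτ : IsTreeSubstitution hd new a b)
    {v : 𝒱} : v ∈ ⋃ n, W hd new a b n ↔ ∃ k, Born hd new a b k v := by
  simp only [Set.mem_iUnion, mem_W hd hτ]
  exact ⟨fun ⟨_, k, _, h⟩ => ⟨k, h⟩, fun ⟨k, h⟩ => ⟨k + 1, k, by omega, h⟩⟩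

/-! ### The edges issued from a branch point -/

/-- New edges all start at a centre, and recolouring keeps the source and the branching time `m +
delay c`. The bounds are the extreme delays `d - 2` and `2d - 3` in a fresh star. Stage `0` is
excluded because the source `a` of its edge is not a centre. -/
lemma born_of_edge {m : ℕ} {x y : 𝒱} {c : Color d} (hm : 1 ≤ m)
    (h : (x, y, c) ∈ (stage hd new a b m).edges) :
    ∃ k, Born hd new a b k x ∧ k + d ≤ m + delay c + 1 ∧ m + delay c + 2 ≤ k + 2 * d := by
  induction m generalizing c with
  | zero => omega
  | succ m ih =>
    rcases (mem_edges_succ hd new a b).1 h with ⟨c, hc, he, rfl⟩ | ⟨x', y', he, rfl, hs⟩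
    · rcases m with _ | m
      · exact absurd ((mem_edges_zero hd new a b).1 he).2.2 hc
      · obtain ⟨k, hk, h1, h2⟩ := ih (by omega) he
        have := delay_recolor hd hc
        exact ⟨k, hk, by omega, by omega⟩
    · refine ⟨m, ⟨x', y', he, rfl⟩, ?_⟩
      rcases hs with ⟨rfl, rfl⟩ | ⟨rfl, rfl⟩ | ⟨k, rfl, rfl⟩
      · rw [delay_letterD]; omega
      · rw [delay_letter1]; omega
      · simp only [delay]; omega

/-- The delays in a fresh star take every value from `d - 2` to `2d - 3`; hence every admissible
branching time `j` is realised by an edge issued from `x`. -/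
lemma exists_edge_of_born {k m j : ℕ} {x : 𝒱} (hx : Born hd new a b k x) (hk : k < m) (hj : m ≤ j)
    (h1 : k + d ≤ j + 1) (h2 : j + 2 ≤ k + 2 * d) :
    ∃ y c, (x, y, c) ∈ (stage hd new a b m).edges ∧ m + delay c = j := by
  induction m, hk using Nat.le_induction with
  | base =>
    obtain ⟨x', y', he, rfl⟩ := hx
    simp only [mem_edges_succ]
    obtain h | h | h : j + 1 = k + d ∨ j = k + d ∨ k + d + 1 ≤ j := by omega
    · refine ⟨x', _, Or.inr ⟨x', y', he, rfl, Or.inl ⟨rfl, rfl⟩⟩, ?_⟩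
      rw [delay_letterD]; omega
    · refine ⟨y', _, Or.inr ⟨x', y', he, rfl, Or.inr (Or.inl ⟨rfl, rfl⟩)⟩, ?_⟩
      rw [delay_letter1]; omega
    · refine ⟨_, _, Or.inr ⟨x', y', he, rfl, Or.inr (Or.inr
        ⟨⟨j - (k + d + 1), by omega⟩, rfl, rfl⟩)⟩, ?_⟩
      simp only [delay]; omega
  | succ m hm ih =>
    obtain ⟨y, c, he, h⟩ := ih (by omega)
    have hc : c ≠ colorTwo hd := fun hc => by
      rw [(delay_eq_zero hd).2 hc] at h; omega
    have := delay_recolor hd hc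
    exact ⟨y, _, (mem_edges_succ hd new a b).2 (Or.inl ⟨c, hc, he, rfl⟩), by omega⟩

/-- A centre issues edges of distinct colours, and `recolor` is injective away from colour 2. Thus a
source has at most one edge branching at a given stage. -/
lemma edge_unique (hτ : IsTreeSubstitution hd new a b) {m : ℕ} {x y y' : 𝒱} {c : Color d}
    (h : (x, y, c) ∈ (stage hd new a b m).edges) (h' : (x, y', c) ∈ (stage hd new a b m).edges) :
    y = y' := by
  induction m generalizing x y y' c with
  | zero =>
    rw [((mem_edges_zero hd new a b).1 h).2.1, ((mem_edges_zero hd new a b).1 h').2.1]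
  | succ m ih =>
    have h1 : letterD hd ≠ letter1 hd := by simp [letterD, letter1]; omega
    rcases (mem_edges_succ hd new a b).1 h with ⟨c, hc, he, rfl⟩ | ⟨x1, y1, he, rfl, hs⟩ <;>
      rcases (mem_edges_succ hd new a b).1 h' with ⟨c', hc', he', hcc⟩ | ⟨x2, y2, he', hx, hs'⟩
    · obtain rfl := recolor_inj hd hc hc' hcc
      exact ih he he'
    · exact absurd (hx ▸ left_mem_verts hd new a b he) (new_notMem_verts hd hτ none he')
    · exact absurd (left_mem_verts hd new a b he') (new_notMem_verts hd hτ none he)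
    · obtain ⟨rfl, rfl, -⟩ := new_inj hd hτ he he' hx
      rcases hs with ⟨rfl, rfl⟩ | ⟨rfl, rfl⟩ | ⟨k, rfl, rfl⟩ <;>
        rcases hs' with ⟨rfl, h'⟩ | ⟨rfl, h'⟩ | ⟨l, rfl, h'⟩ <;> simp_all

end Graphs

end TreeSubst

namespace TreeSubst

/-! ### Connectedness, potentials, and the values of `f₀` at branch points. -/

section Potentials

variable {𝒱 : Type*} {d : ℕ} (hd : 3 ≤ d) (new : Naming 𝒱 d) (a b : 𝒱)

/-! ### Connectedness -/

lemma Reads.append {C : Type*} {X : ColoredGraph 𝒱 C} {x y z : 𝒱} {w w' : List (C × Bool)}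
    (h : Reads X x y w) (h' : Reads X y z w') : Reads X x z (w ++ w') := by
  induction h with
  | nil _ => exact h'
  | forward he _ ih => exact .forward he (ih h')
  | backward he _ ih => exact .backward he (ih h')

/-- Two vertices joined by a path. -/
def Joined {C : Type*} (X : ColoredGraph 𝒱 C) (x y : 𝒱) : Prop := ∃ w, Reads X x y w

lemma Joined.trans {C : Type*} {X : ColoredGraph 𝒱 C} {x y z : 𝒱} (h : Joined X x y)
    (h' : Joined X y z) : Joined X x z := by
  obtain ⟨w, h⟩ := h
  obtain ⟨w', h'⟩ := h'
  exact ⟨_, h.append h'⟩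

lemma joined_of_edge {m : ℕ} {x y : 𝒱} {c : Color d}
    (h : (x, y, c) ∈ (stage hd new a b m).edges) : Joined (stage hd new a b m) x y :=
  ⟨_, .forward h (.nil (right_mem_verts hd new a b h))⟩

lemma joined_of_edge' {m : ℕ} {x y : 𝒱} {c : Color d}
    (h : (x, y, c) ∈ (stage hd new a b m).edges) : Joined (stage hd new a b m) y x :=
  ⟨_, .backward h (.nil (left_mem_verts hd new a b h))⟩

lemma joined_succ_of_edge {m : ℕ} {x y : 𝒱} {c : Color d}
    (h : (x, y, c) ∈ (stage hd new a b m).edges) :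
    Joined (stage hd new a b (m + 1)) x y ∧ Joined (stage hd new a b (m + 1)) y x := by
  by_cases hc : c = colorTwo hd
  · subst hc
    have h1 := (mem_edges_succ hd new a b).2 (Or.inr ⟨x, y, h, rfl, Or.inl ⟨rfl, rfl⟩⟩)
    have h2 := (mem_edges_succ hd new a b).2 (Or.inr ⟨x, y, h, rfl, Or.inr (Or.inl ⟨rfl, rfl⟩)⟩)
    exact ⟨(joined_of_edge' hd new a b h1).trans (joined_of_edge hd new a b h2),
      (joined_of_edge' hd new a b h2).trans (joined_of_edge hd new a b h1)⟩
  · have h1 := (mem_edges_succ hd new a b).2 (Or.inl ⟨c, hc, h, rfl⟩)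
    exact ⟨joined_of_edge hd new a b h1, joined_of_edge' hd new a b h1⟩

lemma Joined.succ {m : ℕ} {x y : 𝒱} (h : Joined (stage hd new a b m) x y) :
    Joined (stage hd new a b (m + 1)) x y := by
  obtain ⟨w, h⟩ := h
  induction h with
  | nil hx => exact ⟨_, .nil (verts_subset_succ hd new a b hx)⟩
  | forward he _ ih => exact (joined_succ_of_edge hd new a b he).1.trans ih
  | backward he _ ih => exact (joined_succ_of_edge hd new a b he).2.trans ih

/-- The trees `τ^m(X_2)` are connected. -/
lemma joined {m : ℕ} {x y : 𝒱} (hx : x ∈ (stage hd new a b m).verts)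
    (hy : y ∈ (stage hd new a b m).verts) : Joined (stage hd new a b m) x y := by
  induction m generalizing x y with
  | zero =>
    have he := (mem_edges_zero hd new a b).2 ⟨rfl, rfl, rfl⟩
    have hx' : x = a ∨ x = b := hx
    have hy' : y = a ∨ y = b := hy
    rcases hx' with rfl | rfl <;> rcases hy' with rfl | rfl
    · exact ⟨_, .nil hx⟩
    · exact joined_of_edge hd new _ _ he
    · exact joined_of_edge' hd new _ _ he
    · exact ⟨_, .nil hx⟩
  | succ m ih =>
    have key : ∀ v ∈ (stage hd new a b (m + 1)).verts, ∃ u ∈ (stage hd new a b m).verts,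
        Joined (stage hd new a b (m + 1)) v u ∧ Joined (stage hd new a b (m + 1)) u v := by
      intro v hv
      rcases (mem_verts_succ hd new a b).1 hv with h | ⟨x', y', i, he, rfl⟩
      · exact ⟨v, (mem_verts hd new a b).2 h, ⟨_, .nil hv⟩, ⟨_, .nil hv⟩⟩
      · have h1 := (mem_edges_succ hd new a b).2 (Or.inr ⟨x', y', he, rfl, Or.inl ⟨rfl, rfl⟩⟩)
        refine ⟨x', left_mem_verts hd new a b he, ?_⟩
        rcases i with _ | k
        · exact ⟨joined_of_edge hd new a b h1, joined_of_edge' hd new a b h1⟩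
        · have h2 := (mem_edges_succ hd new a b).2
            (Or.inr ⟨x', y', he, rfl, Or.inr (Or.inr ⟨k, rfl, rfl⟩)⟩)
          exact ⟨(joined_of_edge' hd new a b h2).trans (joined_of_edge hd new a b h1),
            (joined_of_edge' hd new a b h1).trans (joined_of_edge hd new a b h2)⟩
    obtain ⟨u, hu, h1, -⟩ := key x hx
    obtain ⟨u', hu', -, h2⟩ := key y hy
    exact h1.trans ((ih hu hu').succ.trans h2)

/-- The path function is a word read along some path. -/
lemma reads_pathWord {C : Type*} {X : ColoredGraph 𝒱 C} {x y : 𝒱} (h : Joined X x y) :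
    Reads X x y (pathWord X x y) := by
  classical
  have hex : ∃ n, ∃ w, Reads X x y w ∧ w.length = n := by
    obtain ⟨w, hw⟩ := h
    exact ⟨_, w, hw, rfl⟩
  obtain ⟨w, hw, hn⟩ := Nat.find_spec hex
  exact (Classical.epsilon_spec (p := fun w => Reads X x y w ∧
    ∀ w', Reads X x y w' → w.length ≤ w'.length)
    ⟨w, hw, fun w' hw' => hn ▸ Nat.find_min' hex ⟨w', hw', rfl⟩⟩).1

/-! ### Potentials -/

/-- The element `σ^(j-d+1)(2)` of the free group, also for `j < d - 1`. -/
def weight (j : ℕ) : FreeGroup (Fin d) := (toFree (wordTwo hd j))⁻¹ * toFree (wordTwo hd (j + 1))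

/-- From index `d - 1` on, the quotient is `σ^m(1)⁻¹ σ^(m+1)(1)`. The quotient form also makes sense
at the stages before `T_0^s`, which lets the induction start from the single edge `X_2`. -/
lemma weight_add (m : ℕ) : weight hd (m + (d - 1)) = toFree (wordTwo hd m) := by
  rw [weight, show m + (d - 1) + 1 = m + 1 + (d - 1) by omega, wordTwo_add, wordTwo_add,
    wordOne_succ, toFree_append, inv_mul_cancel_left]

/-- A function whose increments along the edges of `τ^m(X_2)` are the elements of `F_d`
that correspond to their colours. -/
def IsPotential (m : ℕ) (g : 𝒱 → FreeGroup (Fin d)) : Prop :=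
  ∀ x y c, (x, y, c) ∈ (stage hd new a b m).edges → g y = g x * weight hd (m + delay c)

variable {new a b}

lemma IsPotential.center {m : ℕ} {g : 𝒱 → FreeGroup (Fin d)}
    (hg : IsPotential hd new a b (m + 1) g) {x y : 𝒱}
    (h : (x, y, colorTwo hd) ∈ (stage hd new a b m).edges) :
    g (new x y none) = g x * (toFree (wordTwo hd m))⁻¹ := by
  have h1 := hg _ _ _ ((mem_edges_succ hd new a b).2 (Or.inr ⟨x, y, h, rfl, Or.inl ⟨rfl, rfl⟩⟩))
  rw [delay_letterD hd, show m + 1 + (d - 2) = m + (d - 1) by omega, weight_add] at h1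
  rw [h1, mul_inv_cancel_right]

/-- Along `x ← z → y` the increment is `σ^m(2)⁻¹ σ^(m+1)(2)`, the weight of the replaced edge;
recoloured edges keep `m + delay c`. This gives the independence of `f₀` from the stage. -/
lemma IsPotential.of_succ {m : ℕ} {g : 𝒱 → FreeGroup (Fin d)}
    (hg : IsPotential hd new a b (m + 1) g) : IsPotential hd new a b m g := by
  intro x y c he
  by_cases hc : c = colorTwo hd
  · subst hc
    have h2 := hg _ _ _ ((mem_edges_succ hd new a b).2
      (Or.inr ⟨x, y, he, rfl, Or.inr (Or.inl ⟨rfl, rfl⟩)⟩))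
    rw [delay_letter1 hd, weight_add, hg.center hd he] at h2
    rw [h2, delay_colorTwo, add_zero, weight, mul_assoc]
  · have h1 := hg _ _ _ ((mem_edges_succ hd new a b).2 (Or.inl ⟨c, hc, he, rfl⟩))
    rw [h1, ← delay_recolor hd hc]
    congr 2
    omega

lemma IsPotential.of_le {m n : ℕ} (h : m ≤ n) {g : 𝒱 → FreeGroup (Fin d)}
    (hg : IsPotential hd new a b n g) : IsPotential hd new a b m g := by
  induction n, h using Nat.le_induction with
  | base => exact hg
  | succ n _ ih => exact ih (hg.of_succ hd)

lemma IsPotential.exists_succ (hτ : IsTreeSubstitution hd new a b) {m : ℕ}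
    {g : 𝒱 → FreeGroup (Fin d)} (hg : IsPotential hd new a b m g) :
    ∃ g', IsPotential hd new a b (m + 1) g' ∧ ∀ v ∈ (stage hd new a b m).verts, g' v = g v := by
  classical
  let P : 𝒱 → 𝒱 × 𝒱 × Option (Fin (d - 2)) → Prop := fun v p =>
    (p.1, p.2.1, colorTwo hd) ∈ (stage hd new a b m).edges ∧ v = new p.1 p.2.1 p.2.2
  -- The value at the centre is forced by `IsPotential.center`; the value at a leaf then adds the
  -- weight of its edge, whose delay is `d + k`.
  let val : 𝒱 × 𝒱 × Option (Fin (d - 2)) → FreeGroup (Fin d) := fun p =>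
    g p.1 * (toFree (wordTwo hd m))⁻¹ *
      p.2.2.elim 1 fun k => weight hd (m + 1 + (d + k.val))
  let g' : 𝒱 → FreeGroup (Fin d) := fun v => if h : ∃ p, P v p then val h.choose else g v
  have hold : ∀ v ∈ (stage hd new a b m).verts, g' v = g v := by
    intro v hv
    refine dif_neg ?_
    rintro ⟨p, hp, rfl⟩
    exact new_notMem_verts hd hτ _ hp hv
  have hnew : ∀ x y i, (x, y, colorTwo hd) ∈ (stage hd new a b m).edges →
      g' (new x y i) = val (x, y, i) := by
    intro x y i he
    have hex : ∃ p, P (new x y i) p := ⟨(x, y, i), he, rfl⟩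
    have h1 : g' (new x y i) = val hex.choose := dif_pos hex
    obtain ⟨h2, h3⟩ := hex.choose_spec
    obtain ⟨e1, e2, e3⟩ := new_inj hd hτ he h2 h3
    rw [h1]
    congr 1
    exact Prod.ext e1.symm (Prod.ext e2.symm e3.symm)
  refine ⟨g', ?_, hold⟩
  intro u v c' huv
  rcases (mem_edges_succ hd new a b).1 huv with ⟨c, hc, he, rfl⟩ | ⟨x, y, he, rfl, hs⟩
  · rw [hold _ (left_mem_verts hd new a b he), hold _ (right_mem_verts hd new a b he),
      hg _ _ _ he, ← delay_recolor hd hc]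
    congr 2
    omega
  · rw [hnew x y none he]
    rcases hs with ⟨rfl, rfl⟩ | ⟨rfl, rfl⟩ | ⟨k, rfl, rfl⟩
    · rw [hold _ (left_mem_verts hd new a b he), delay_letterD hd,
        show m + 1 + (d - 2) = m + (d - 1) by omega, weight_add]
      simp [val]
    · rw [hold _ (right_mem_verts hd new a b he), delay_letter1 hd, weight_add, hg _ _ _ he,
        delay_colorTwo, add_zero, weight]
      simp [val, mul_assoc]
    · rw [hnew x y _ he]
      simp [val, delay]

lemma exists_isPotential (hτ : IsTreeSubstitution hd new a b) (m : ℕ) :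
    ∃ g, IsPotential hd new a b (m + 1) g ∧ g (root new a b) = 1 := by
  classical
  induction m with
  | zero =>
    -- With the value `2` at `a`, the centre of the first star, which is the root, gets the value
    -- `1`.
    have h0 : IsPotential hd new a b 0 fun v =>
        if v = b then toFree (wordTwo hd 1) else toFree (wordTwo hd 0) := by
      intro x y c he
      obtain ⟨rfl, rfl, rfl⟩ := (mem_edges_zero hd new a b).1 he
      simp only [if_true, if_neg hτ.ne]
      rw [delay_colorTwo, weight, mul_inv_cancel_left]
    obtain ⟨g, hg, hag⟩ := h0.exists_succ hd hτ
    refine ⟨g, hg, ?_⟩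
    have he := (mem_edges_zero hd new a b).2 ⟨rfl, rfl, rfl⟩
    rw [root, hg.center hd he, hag a (left_mem_verts hd new a b he), if_neg hτ.ne, mul_inv_cancel]
  | succ m ih =>
    obtain ⟨g, hg, h1⟩ := ih
    obtain ⟨g', hg', hag⟩ := hg.exists_succ hd hτ
    exact ⟨g', hg', by rw [hag _ (root_mem_verts hd new a b (by omega)), h1]⟩

/-- Valid for every path, so neither acyclicity nor uniqueness of shortest paths is needed to
evaluate `pathWord`. -/
lemma IsPotential.eq_of_reads {n : ℕ} {g : 𝒱 → FreeGroup (Fin d)}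
    (hg : IsPotential hd new a b (n + (d - 1)) g) {x y : 𝒱} {w : List (Color d × Bool)}
    (h : Reads (T hd new a b n) x y w) : g y = g x * (sigma hd)^[n] (pStar hd w) := by
  have hcons : ∀ (l : Color d × Bool) (w : List (Color d × Bool)),
      (sigma hd)^[n] (pStar hd (l :: w)) =
        (sigma hd)^[n] (if l.2 then pLetter hd l.1 else (pLetter hd l.1)⁻¹) *
          (sigma hd)^[n] (pStar hd w) := fun l w => by
    simp only [pStar, List.map_cons, List.prod_cons, iterate_map_mul]
  have hw : ∀ c, weight hd (n + (d - 1) + delay c) = (sigma hd)^[n] (pLetter hd c) := fun c => by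
    rw [show n + (d - 1) + delay c = n + delay c + (d - 1) by omega, weight_add,
      iterate_sigma_pLetter]
  rw [T_eq_stage] at h
  induction h with
  | nil _ => simp [pStar]
  | forward he _ ih => rw [hcons, ih, hg _ _ _ he, hw, mul_assoc]; rfl
  | backward he _ ih =>
    rw [hcons, ih, hg _ _ _ he, hw]
    simp [iterate_map_inv, mul_assoc]

lemma IsPotential.stageImage_eq {n : ℕ} {g : 𝒱 → FreeGroup (Fin d)}
    (hg : IsPotential hd new a b (n + (d - 1)) g) (h1 : g (root new a b) = 1) {x : 𝒱}
    (hx : x ∈ (T hd new a b n).verts) : stageImage hd new a b n x = g x := by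
  have hj : Joined (T hd new a b n) (root new a b) x := by
    rw [T_eq_stage] at hx ⊢
    exact joined hd new a b (root_mem_verts hd new a b (by omega)) hx
  rw [hg.eq_of_reads hd (reads_pathWord hj), h1, one_mul, stageImage]

/-- The value `f₀(x)` can be computed in every tree that has `x` as a vertex. -/
lemma f₀_eq_stageImage (hτ : IsTreeSubstitution hd new a b) {n : ℕ} {x : 𝒱}
    (hx : x ∈ (T hd new a b n).verts) : f₀ hd new a b x = stageImage hd new a b n x := by
  have hmem : sInf {k : ℕ | x ∈ (T hd new a b k).verts} ∈ {k : ℕ | x ∈ (T hd new a b k).verts} :=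
    Nat.sInf_mem ⟨n, hx⟩
  have hle : sInf {k : ℕ | x ∈ (T hd new a b k).verts} ≤ n := Nat.sInf_le hx
  obtain ⟨g, hg, h1⟩ := exists_isPotential hd hτ (n + (d - 1))
  rw [(hg.of_succ hd).stageImage_eq hd h1 hx, f₀]
  exact (hg.of_le hd (by omega)).stageImage_eq hd h1 hmem

lemma f₀_eq (hτ : IsTreeSubstitution hd new a b) {n : ℕ} {g : 𝒱 → FreeGroup (Fin d)}
    (hg : IsPotential hd new a b (n + (d - 1)) g) (h1 : g (root new a b) = 1) {x : 𝒱}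
    (hx : x ∈ (stage hd new a b (n + (d - 1))).verts) : f₀ hd new a b x = g x := by
  rw [← T_eq_stage] at hx
  rw [f₀_eq_stageImage hd hτ hx, hg.stageImage_eq hd h1 hx]

lemma f₀_root (hτ : IsTreeSubstitution hd new a b) : f₀ hd new a b (root new a b) = 1 := by
  obtain ⟨g, hg, h1⟩ := exists_isPotential hd hτ (d - 1)
  rw [f₀_eq hd hτ (n := 0) (hg.of_le hd (by omega)) h1 (root_mem_verts hd new a b (by omega)), h1]

lemma isPotential_f₀ (hτ : IsTreeSubstitution hd new a b) (m : ℕ) :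
    IsPotential hd new a b m (f₀ hd new a b) := by
  -- `f₀` is computed in the trees `T`, that is from stage `d - 1` on; the earlier stages are
  -- reached by restricting the potential.
  refine IsPotential.of_le hd (n := m + (d - 1)) (by omega) fun x y c he => ?_
  obtain ⟨g, hg, h1⟩ := exists_isPotential hd hτ (m + (d - 1))
  rw [f₀_eq hd hτ (hg.of_succ hd) h1 (left_mem_verts hd new a b he),
    f₀_eq hd hτ (hg.of_succ hd) h1 (right_mem_verts hd new a b he), hg.of_succ hd _ _ _ he]

/-! ### Branch points and prefixes of `ω` -/

lemma f₀_center (hτ : IsTreeSubstitution hd new a b) {m : ℕ} {x y : 𝒱}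
    (h : (x, y, colorTwo hd) ∈ (stage hd new a b m).edges) :
    f₀ hd new a b (new x y none) = f₀ hd new a b x * (toFree (wordTwo hd m))⁻¹ :=
  (isPotential_f₀ hd hτ (m + 1)).center hd h

/-- `σ^m(2)` followed by a short prefix of `ω`. -/
lemma toFree_pre_add {m i : ℕ} (hm : d ≤ m + 1) (hi : i < count hd (m + 2 - d)) :
    (toFree (pre hd i))⁻¹ * (toFree (wordTwo hd m))⁻¹ =
      (toFree (pre hd ((wordTwo hd m).length + i)))⁻¹ := by
  obtain ⟨l, rfl⟩ : ∃ l, m = l + (d - 1) := ⟨m - (d - 1), by omega⟩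
  rw [show l + (d - 1) + 2 - d = l + 1 by omega] at hi
  rw [wordTwo_add, ← wordOne_append_pre hd l i hi, toFree_append, mul_inv_rev]

lemma Born.source {m : ℕ} (hm : 1 ≤ m) {x y : 𝒱}
    (h : (x, y, colorTwo hd) ∈ (stage hd new a b m).edges) :
    ∃ k < m, Born hd new a b k x ∧ k + d ≤ m + 1 ∧ m + 2 ≤ k + 2 * d := by
  obtain ⟨k, hk, h1, h2⟩ := born_of_edge hd hm h
  rw [delay_colorTwo] at h1 h2
  exact ⟨k, by omega, hk, h1, h2⟩

lemma born_zero {z : 𝒱} : Born hd new a b 0 z ↔ z = root new a b := by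
  simp only [Born, mem_edges_zero]
  constructor
  · rintro ⟨x, y, ⟨rfl, rfl, -⟩, rfl⟩
    rfl
  · rintro rfl
    exact ⟨a, b, ⟨rfl, rfl, trivial⟩, rfl⟩

lemma count_one : count hd 1 = 1 := by
  rw [count_succ, length_wordTwo_of_lt hd 0 (by omega), show 0 + 2 - d = 0 by omega, count_zero]

lemma Born.f₀_eq (hτ : IsTreeSubstitution hd new a b) {m : ℕ} {z : 𝒱}
    (hz : Born hd new a b m z) :
    ∃ i ∈ Set.Ico (count hd m) (count hd (m + 1)), f₀ hd new a b z = (toFree (pre hd i))⁻¹ := by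
  induction m using Nat.strong_induction_on generalizing z with
  | _ m ih =>
    rcases Nat.eq_zero_or_pos m with rfl | hm
    · rw [(born_zero hd).1 hz, f₀_root hd hτ]
      exact ⟨0, by simp [count_one], by simp [pre, toFree]⟩
    · obtain ⟨x, y, he, rfl⟩ := hz
      obtain ⟨k, hk, hx, h1, h2⟩ := Born.source hd hm he
      obtain ⟨i, ⟨hi1, hi2⟩, hi⟩ := ih k hk hx
      have m1 := count_mono hd (show m + 2 - 2 * d ≤ k by omega)
      have m2 := count_mono hd (show k + 1 ≤ m + 2 - d by omega)
      refine ⟨(wordTwo hd m).length + i, ⟨?_, ?_⟩, ?_⟩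
      · rw [count_eq hd m hm]; omega
      · rw [count_succ]; omega
      · rw [f₀_center hd hτ he, hi, toFree_pre_add hd (by omega) (by omega)]

/-- Subtracting `|σ^m(2)|` from `i` gives the length attached to an earlier centre, whose edge
branching at stage `m` creates the required one. -/
lemma exists_born (hτ : IsTreeSubstitution hd new a b) {m i : ℕ}
    (hi : i ∈ Set.Ico (count hd m) (count hd (m + 1))) :
    ∃ z, Born hd new a b m z ∧ f₀ hd new a b z = (toFree (pre hd i))⁻¹ := by
  induction m using Nat.strong_induction_on generalizing i with
  | _ m ih =>
    obtain ⟨h1, h2⟩ := hi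
    rcases Nat.eq_zero_or_pos m with rfl | hm
    · rw [zero_add, count_one] at h2
      obtain rfl : i = 0 := by omega
      exact ⟨_, (born_zero hd).2 rfl, by simp [f₀_root hd hτ, pre, toFree]⟩
    · rw [count_eq hd m hm] at h1
      rw [count_succ] at h2
      obtain ⟨j, rfl⟩ := Nat.exists_eq_add_of_le (le_of_add_le_left h1)
      obtain ⟨k, hk1, hk2, hk⟩ := exists_mem_Ico_count hd (i := j) (m := m + 2 - 2 * d)
        (n := m + 2 - d) (by omega) (by omega)
      obtain ⟨x, hx, hfx⟩ := ih k (by omega) hk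
      obtain ⟨y, c, he, hc⟩ := exists_edge_of_born hd hx (m := m) (j := m) (by omega) le_rfl
        (by omega) (by omega)
      obtain rfl := (delay_eq_zero hd).1 (show delay c = 0 by omega)
      refine ⟨_, ⟨x, y, he, rfl⟩, ?_⟩
      rw [f₀_center hd hτ he, hfx, toFree_pre_add hd (by omega) (by omega)]

lemma pre_index_inj {i j : ℕ} (h : (toFree (pre hd i))⁻¹ = (toFree (pre hd j))⁻¹) : i = j := by
  simpa using length_eq_of_toFree_eq (inv_injective h)

/-- The value determines the length, and the disjoint intervals of `count` then determine the stage
of birth. Cancelling `σ^m(2)⁻¹` reduces to the sources, which agree by induction, and a source has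
one edge of colour 2. -/
lemma born_injective (hτ : IsTreeSubstitution hd new a b) {m m' : ℕ} {z z' : 𝒱}
    (hz : Born hd new a b m z) (hz' : Born hd new a b m' z')
    (h : f₀ hd new a b z = f₀ hd new a b z') : z = z' := by
  induction m using Nat.strong_induction_on generalizing m' z z' with
  | _ m ih =>
    obtain rfl : m = m' := by
      obtain ⟨i, ⟨h1, h2⟩, hi⟩ := hz.f₀_eq hd hτ
      obtain ⟨j, ⟨h3, h4⟩, hj⟩ := hz'.f₀_eq hd hτ
      rw [hi, hj] at h
      obtain rfl := pre_index_inj hd h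
      by_contra hne
      rcases Nat.lt_or_gt_of_ne hne with hlt | hlt
      · have := count_mono hd (Nat.succ_le_of_lt hlt); simp only [Nat.succ_eq_add_one] at this; omega
      · have := count_mono hd (Nat.succ_le_of_lt hlt); simp only [Nat.succ_eq_add_one] at this; omega
    rcases Nat.eq_zero_or_pos m with rfl | hm
    · rw [(born_zero hd).1 hz, (born_zero hd).1 hz']
    · obtain ⟨x, y, he, rfl⟩ := hz
      obtain ⟨x', y', he', rfl⟩ := hz'
      rw [f₀_center hd hτ he, f₀_center hd hτ he'] at h
      obtain ⟨k, hk, hx, -⟩ := Born.source hd hm he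
      obtain ⟨k', -, hx', -⟩ := Born.source hd hm he'
      obtain rfl := ih k hk hx hx' (mul_right_cancel h)
      rw [edge_unique hd hτ he he']

lemma exists_f₀_eq (hτ : IsTreeSubstitution hd new a b) {x : 𝒱}
    (hx : x ∈ ⋃ n, W hd new a b n) : ∃ i, f₀ hd new a b x = (toFree (pre hd i))⁻¹ := by
  obtain ⟨k, hk⟩ := (mem_iUnion_W hd hτ).1 hx
  obtain ⟨i, -, hi⟩ := hk.f₀_eq hd hτ
  exact ⟨i, hi⟩

lemma exists_mem_W_f₀_eq (hτ : IsTreeSubstitution hd new a b) (i : ℕ) :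
    ∃ x ∈ ⋃ n, W hd new a b n, f₀ hd new a b x = (toFree (pre hd i))⁻¹ := by
  obtain ⟨k, -, -, hk⟩ := exists_mem_Ico_count hd (m := 0) (by simp) (lt_count hd i)
  obtain ⟨z, hz, h⟩ := exists_born hd hτ hk
  exact ⟨z, (mem_iUnion_W hd hτ).2 ⟨k, hz⟩, h⟩

lemma f₀_injOn (hτ : IsTreeSubstitution hd new a b) :
    Set.InjOn (f₀ hd new a b) (⋃ n, W hd new a b n) := by
  intro x hx y hy h
  obtain ⟨k, hk⟩ := (mem_iUnion_W hd hτ).1 hx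
  obtain ⟨l, hl⟩ := (mem_iUnion_W hd hτ).1 hy
  exact born_injective hd hτ hk hl h

lemma pre_append_drop (i : ℕ) : pre hd i ++ₛ (omega hd).drop i = omega hd :=
  Stream'.append_take_drop i (omega hd)

end Potentials

end TreeSubst

theorem mainTheorem6 {𝒱 : Type*} {d : ℕ} (hd : 3 ≤ d) (new : TreeSubst.Naming 𝒱 d) (a b : 𝒱)
    (hτ : TreeSubst.IsTreeSubstitution hd new a b) :
    -- `f₀(x) = σ^k(p_*(γ_k(x₀, x)))` for every `k` such that `x` is a vertex of `T_k^s`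
    (∀ x ∈ ⋃ n, TreeSubst.W hd new a b n, ∀ k, x ∈ (TreeSubst.T hd new a b k).verts →
      TreeSubst.f₀ hd new a b x = TreeSubst.stageImage hd new a b k x) ∧
    -- `f₀` is a bijection from the branch points onto the words `u⁻¹`, `u` a prefix of `ω`
    Set.BijOn (TreeSubst.f₀ hd new a b) (⋃ n, TreeSubst.W hd new a b n)
      {g | ∃ u : List (Fin d), TreeSubst.IsPrefix u (TreeSubst.omega hd) ∧
        g = (TreeSubst.toFree u)⁻¹} ∧
    -- sending `x` with `f₀(x) = u⁻¹` to `u⁻¹ω` is a bijection onto the shifts of `ω`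
    ∃ Φ : 𝒱 → Stream' (Fin d),
      (∀ x ∈ ⋃ n, TreeSubst.W hd new a b n, ∃ u : List (Fin d),
        TreeSubst.f₀ hd new a b x = (TreeSubst.toFree u)⁻¹ ∧
        TreeSubst.omega hd = u ++ₛ Φ x) ∧
      Set.BijOn Φ (⋃ n, TreeSubst.W hd new a b n)
        {V | ∃ n : ℕ, V = (TreeSubst.omega hd).drop n} := by
  classical
  refine ⟨fun x _ k hk => TreeSubst.f₀_eq_stageImage hd hτ hk,
    ⟨fun x hx => ?_, TreeSubst.f₀_injOn hd hτ, ?_⟩, ?_⟩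
  · obtain ⟨i, hi⟩ := TreeSubst.exists_f₀_eq hd hτ hx
    exact ⟨TreeSubst.pre hd i, (TreeSubst.isPrefix_iff hd _).2 (by simp), hi⟩
  · rintro _ ⟨u, hu, rfl⟩
    obtain ⟨x, hx, h⟩ := TreeSubst.exists_mem_W_f₀_eq hd hτ u.length
    exact ⟨x, hx, by rw [h, ← (TreeSubst.isPrefix_iff hd u).1 hu]⟩
  · choose! idx hidx using fun x hx => TreeSubst.exists_f₀_eq hd hτ (x := x) hx
    refine ⟨fun x => (TreeSubst.omega hd).drop (idx x), fun x hx =>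
      ⟨TreeSubst.pre hd (idx x), hidx x hx, (TreeSubst.pre_append_drop hd _).symm⟩,
      fun x _ => ⟨idx x, rfl⟩, fun x hx y hy h => ?_, ?_⟩
    · have h' : idx x = idx y := TreeSubst.drop_omega_injective hd h
      exact TreeSubst.f₀_injOn hd hτ hx hy (by rw [hidx x hx, hidx y hy, h'])
    · rintro _ ⟨n, rfl⟩
      obtain ⟨x, hx, h⟩ := TreeSubst.exists_mem_W_f₀_eq hd hτ n
      have h' : idx x = n := TreeSubst.pre_index_inj hd ((hidx x hx).symm.trans h)
      exact ⟨x, hx, by simp only [h']⟩
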